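/- **Theorem (Nash Equilibrium Algorithm).** In the *Bakers and Millers Game with restricted baker locations* there are finite sets $\mathcal B$ of bakers, $\mathcal M$ of millers and $\mathcal L\neq\varnothing$ of locations, and every baker $b$ has a nonempty set $L(b)\subseteq\mathcal L$ of feasible locations. A strategy profile $(\mathbf s,\mathbf t)$ consists of a location $s_b\in L(b)$ for each baker and a location $t_m\in\mathcal L$ for each miller. Let $B_{\mathbf s}(\ell)=|\{b: s_b=\ell\}|$ and $M_{\mathbf t}(\ell)=|\{m: t_m=\ell\}|$. The utilities are $u_b(\mathbf s,\mathbf t)=M_{\mathbf t}(s_b)/B_{\mathbf s}(s_b)$ for a baker $b$ and $u_m(\mathbf s,\mathbf t)=B_{\mathbf s}(t_m)/M_{\mathbf t}(t_m)$ for a miller $m$. The profile is a *pure Nash equilibrium* if no baker $b$ can strictly increase her utility by moving alone to another location in $L(b)$ and no miller can strictly increase her utility by moving alone to another location in $\mathcal L$. Consider the following algorithm. 1. For $i=1,\dots,|\mathcal L|$, let $\ell_i$ be a location, among those not selected before, that is feasible for the largest number of still unassigned bakers (ties are broken arbitrarily), and assign all still unassigned bakers $b$ with $\ell_i\in L(b)$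 to $\ell_i$. This gives a baker profile $\mathbf s$. 2. Insert the millers one by one, in an arbitrary order, each at the location $\ell$ that maximizes $B_{\mathbf s}(\ell)/(M_{\mathbf t}(\ell)+1)$, where $M_{\mathbf t}(\ell)$ counts the millers inserted so far at $\ell$; among several maximizing locations, the one with the smallest index in the order $\ell_1,\ell_2,\dots$ is taken. This gives a miller profile $\mathbf t^*$. 3. Let $\mathbf s^*$ be any baker profile that maximizes the Rosenthal potential $\Phi_{\mathbf t^*}(\mathbf x)=\sum_{\ell\in\mathcal L}M_{\mathbf t^*}(\ell)\,H_{B_{\mathbf x}(\ell)}$ over all baker profiles $\mathbf x$, where $H_n=\sum_{k=1}^n 1/k$. Return $(\mathbf s^*,\mathbf t^*)$. Then: - (Correctness) Every run of the algorithm, for all choices left open above, returns a pure Nash equilibrium. - (Running time) The algorithm can be carried out in polynomial time: there are a single program for a random access machine, whose arithmetic operations are addition and truncated subtraction of natural numbers and each of whose operations takes one step, and a polynomial $f$ such that on every game with $|\mathcal L|\ge1$, given by the numbers $|\mathcal B|,|\mathcal M|,|\mathcal L|$ and the 0-1 matrix of the relation $\ell\in L(b)$, the program halts after at most $f(|\mathcal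 B|+|\mathcal M|+|\mathcal L|)$ steps and outputs the order $(\ell_i)$ and the profiles $\mathbf s,\mathbf t^*,\mathbf s^*$ of some run of the algorithm; in particular it outputs a pure Nash equilibrium $(\mathbf s^*,\mathbf t^*)$. - (Existence) Every such game has a pure Nash equilibrium. -/

import Mathlib

namespace BakersMillers

/-! ### The Bakers and Millers Game with restricted baker locations -/

/-- The game with bakers `B`, millers `M` and locations `L`: each baker has a nonempty set of
feasible locations, and each miller may choose any location. -/
structure Game (B M L : Type*) where
  /-- the set `L(b)` of feasible locations of a baker -/
  feas : B → Finset L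
  feas_nonempty : ∀ b, (feas b).Nonempty

/-- The number of agents at location `l` when the agents choose their locations according to `x`.
For a baker profile `s` this is `B_s(l)`, for a miller profile `t` it is `M_t(l)`. -/
def count {A L : Type*} [Fintype A] [DecidableEq L] (x : A → L) (l : L) : ℕ :=
  (Finset.univ.filter fun a => x a = l).card

section Utilities

variable {B M L : Type*} [Fintype B] [Fintype M] [DecidableEq L]

/-- Utility of baker `b`: number of millers divided by number of bakers at her location. -/
def bakerUtility (s : B → L) (t : M → L) (b : B) : ℚ :=
  (count t (s b) : ℚ) / (count s (s b) : ℚ)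

/-- Utility of miller `m`: number of bakers divided by number of millers at her location. -/
def millerUtility (s : B → L) (t : M → L) (m : M) : ℚ :=
  (count s (t m) : ℚ) / (count t (t m) : ℚ)

/-- The Rosenthal potential `Φ_t(s) = ∑_l M_t(l) · H_{B_s(l)}` of the bakers' game for a fixed
miller profile `t`. -/
def potential [Fintype L] (t : M → L) (s : B → L) : ℚ :=
  ∑ l, (count t l : ℚ) * harmonic (count s l)

end Utilities

namespace Game

variable {B M L : Type*} [Fintype B] [Fintype M] [DecidableEq L]

/-- `s` is a baker strategy profile: every baker chooses one of her feasible locations. -/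
def Feasible (G : Game B M L) (s : B → L) : Prop := ∀ b, s b ∈ G.feas b

/-- No baker can improve her utility by moving to another feasible location. -/
def IsBakerEquilibrium [DecidableEq B] (G : Game B M L) (s : B → L) (t : M → L) : Prop :=
  ∀ b, ∀ l ∈ G.feas b,
    ¬ bakerUtility (Function.update s b l) t b > bakerUtility s t b

/-- No miller can improve her utility by moving to another location. -/
def IsMillerEquilibrium [DecidableEq M] (_G : Game B M L) (s : B → L) (t : M → L) : Prop :=
  ∀ m, ∀ l : L,
    ¬ millerUtility s (Function.update t m l) m > millerUtility s t m

/-- `(s, t)` is a strategy profile that is a pure Nash equilibrium. -/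
def IsPureNash [DecidableEq B] [DecidableEq M] (G : Game B M L) (s : B → L) (t : M → L) : Prop :=
  G.Feasible s ∧ G.IsBakerEquilibrium s t ∧ G.IsMillerEquilibrium s t

/-! ### The algorithm -/

/-- For an order `l_0, l_1, …` of the locations, the set of bakers that are still unassigned when
location `l_i` is selected: none of the earlier locations is feasible for them. -/
def unassigned {p : ℕ} (G : Game B M L) (ord : Fin p ≃ L) (i : Fin p) : Finset B :=
  Finset.univ.filter fun b => ∀ j < i, ord j ∉ G.feas b

/-- The number of bakers in range of `l` that are still unassigned in round `i`. -/
def inRange {p : ℕ} (G : Game B M L) (ord : Fin p ≃ L) (i : Fin p) (l : L) : ℕ :=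
  ((G.unassigned ord i).filter fun b => l ∈ G.feas b).card

/-- In round `i`, the selected location `l_i` has, among the locations that have not been selected
before, a largest number of still unassigned bakers in range. Ties are broken arbitrarily. -/
def IsGreedyOrder {p : ℕ} (G : Game B M L) (ord : Fin p ≃ L) : Prop :=
  ∀ i j, i ≤ j → G.inRange ord i (ord j) ≤ G.inRange ord i (ord i)

/-- In round `i`, all still unassigned bakers in range of `l_i` are assigned to `l_i`. -/
def IsGreedyAssignment {p : ℕ} (G : Game B M L) (ord : Fin p ≃ L) (s : B → L) : Prop :=
  ∀ i, ∀ b ∈ G.unassigned ord i, ord i ∈ G.feas b → s b = ord i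

/-- When the millers are inserted in the order `e 0, e 1, …` and choose the locations given by `t`,
this is the number of millers at `l` just before miller `e k` is inserted. -/
def placed {q : ℕ} (e : Fin q ≃ M) (t : M → L) (k : Fin q) (l : L) : ℕ :=
  (Finset.univ.filter fun j => j < k ∧ t (e j) = l).card

/-- The utility that miller `e k` gets if she is inserted at location `l`. -/
def insertionValue {q : ℕ} (s : B → L) (e : Fin q ≃ M) (t : M → L) (k : Fin q) (l : L) : ℚ :=
  (count s l : ℚ) / ((placed e t k l : ℚ) + 1)

/-- The millers are inserted one by one in the order `e 0, e 1, …`, each at the location of smallest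
index (with respect to `ord`) among those that maximize `B_s(l) / (M_t(l) + 1)`. -/
def IsInsertion {p q : ℕ} (ord : Fin p ≃ L) (s : B → L) (e : Fin q ≃ M) (t : M → L) : Prop :=
  ∀ k, ∃ i, t (e k) = ord i ∧
    (∀ j, insertionValue s e t k (ord j) ≤ insertionValue s e t k (ord i)) ∧
    (∀ j < i, insertionValue s e t k (ord j) < insertionValue s e t k (ord i))

/-- `s` is a baker strategy profile that maximizes the potential for the miller profile `t`. -/
def IsPotentialMaximizer [Fintype L] (G : Game B M L) (t : M → L) (s : B → L) : Prop :=
  G.Feasible s ∧ ∀ x : B → L, G.Feasible x → potential t x ≤ potential t s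

/-- A complete run of the algorithm that returns the profile `(s', t)`: the locations are ordered
and the bakers assigned greedily (`ord`, `s`), the millers are inserted in the order `e` (`t`), and
finally the bakers are reassigned to a maximizer `s'` of the potential. -/
structure IsRun [Fintype L] {p q : ℕ} (G : Game B M L) (ord : Fin p ≃ L) (s : B → L)
    (e : Fin q ≃ M) (t : M → L) (s' : B → L) : Prop where
  order : G.IsGreedyOrder ord
  assignment : G.IsGreedyAssignment ord s
  insertion : IsInsertion ord s e t
  maximizer : G.IsPotentialMaximizer t s'

end Game

/-! ### The machine model

Structured programs for a random access machine whose memory consists of registers and arrays of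
natural numbers. The arithmetic operations are addition and truncated subtraction; each operation
takes one step. There is no unit-cost multiplication, so the numbers that occur have length at most
linear in the number of steps plus the length of the input, and polynomial time on this machine is
polynomial time on a Turing machine. -/

/-- Expressions. -/
inductive Expr where
  /-- a constant -/
  | const (n : ℕ)
  /-- the content of register `r` -/
  | reg (r : ℕ)
  /-- the content of cell `i` of array `a`, where `i` is the value of an expression -/
  | get (a : ℕ) (i : Expr)
  | add (x y : Expr)
  | sub (x y : Expr)

/-- Programs. -/
inductive Prog where
  | skip
  /-- register `r` gets the value of `x` -/
  | set (r : ℕ) (x : Expr)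
  /-- cell `i` of array `a` gets the value of `x` -/
  | store (a : ℕ) (i x : Expr)
  | seq (P Q : Prog)
  /-- if `c` is nonzero then `P`, else `Q` -/
  | ite (c : Expr) (P Q : Prog)
  /-- while `c` is nonzero do `P` -/
  | loop (c : Expr) (P : Prog)

/-- The content of the memory. -/
structure Memory where
  reg : ℕ → ℕ
  arr : ℕ → ℕ → ℕ

namespace Memory

/-- Overwrite register `r`. -/
def setReg (σ : Memory) (r v : ℕ) : Memory :=
  { σ with reg := Function.update σ.reg r v }

/-- Overwrite cell `i` of array `a`. -/
def setArr (σ : Memory) (a i v : ℕ) : Memory :=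
  { σ with arr := Function.update σ.arr a (Function.update (σ.arr a) i v) }

end Memory

namespace Expr

/-- The value of an expression. -/
def val (σ : Memory) : Expr → ℕ
  | const n => n
  | reg r => σ.reg r
  | get a i => σ.arr a (i.val σ)
  | add x y => x.val σ + y.val σ
  | sub x y => x.val σ - y.val σ

/-- The number of steps to evaluate an expression: one for each operation in it. -/
def cost : Expr → ℕ
  | const _ => 1
  | reg _ => 1
  | get _ i => i.cost + 1
  | add x y => x.cost + y.cost + 1
  | sub x y => x.cost + y.cost + 1

end Expr

/-- `Exec P σ n τ`: started with memory `σ`, program `P` halts after `n` steps with memory `τ`. -/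
inductive Exec : Prog → Memory → ℕ → Memory → Prop
  | skip (σ : Memory) : Exec .skip σ 1 σ
  | set (σ : Memory) (r : ℕ) (x : Expr) :
      Exec (.set r x) σ (x.cost + 1) (σ.setReg r (x.val σ))
  | store (σ : Memory) (a : ℕ) (i x : Expr) :
      Exec (.store a i x) σ (i.cost + x.cost + 1) (σ.setArr a (i.val σ) (x.val σ))
  | seq {P Q : Prog} {σ τ ρ : Memory} {m n : ℕ} :
      Exec P σ m τ → Exec Q τ n ρ → Exec (.seq P Q) σ (m + n) ρ
  | ite_true {c : Expr} {P Q : Prog} {σ τ : Memory} {n : ℕ} :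
      c.val σ ≠ 0 → Exec P σ n τ → Exec (.ite c P Q) σ (c.cost + 1 + n) τ
  | ite_false {c : Expr} {P Q : Prog} {σ τ : Memory} {n : ℕ} :
      c.val σ = 0 → Exec Q σ n τ → Exec (.ite c P Q) σ (c.cost + 1 + n) τ
  | loop_true {c : Expr} {P : Prog} {σ τ ρ : Memory} {m n : ℕ} :
      c.val σ ≠ 0 → Exec P σ m τ → Exec (.loop c P) τ n ρ →
        Exec (.loop c P) σ (c.cost + 1 + m + n) ρ
  | loop_false {c : Expr} {P : Prog} {σ : Memory} :
      c.val σ = 0 → Exec (.loop c P) σ (c.cost + 1) σ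

/-- The input of a program: registers 0, 1, 2 hold the numbers of bakers, millers and locations, and
array 0 holds, row by row, the 0-1 matrix that tells which locations are feasible for which bakers.
All other cells are zero. -/
def Game.encode {nb nm nl : ℕ} (G : Game (Fin nb) (Fin nm) (Fin nl)) : Memory where
  reg r := if r = 0 then nb else if r = 1 then nm else if r = 2 then nl else 0
  arr a k :=
    if a = 0 ∧ ∃ (b : Fin nb) (l : Fin nl), k = (b : ℕ) * nl + (l : ℕ) ∧ l ∈ G.feas b
    then 1 else 0

/-- Array `a` of the memory holds (in its first `k` cells) the sequence `x`. -/
def Memory.Holds {k n : ℕ} (σ : Memory) (a : ℕ) (x : Fin k → Fin n) : Prop :=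
  ∀ i : Fin k, σ.arr a (i : ℕ) = (x i : ℕ)

end BakersMillers

open BakersMillers

/-! Correctness. A maximizer of the potential admits no improving chain of baker moves
(`Game.IsPotentialMaximizer.stable`): bakers moved along a path of feasible moves change only the
counts at its two ends. Paths of length one give the baker equilibrium. For the millers, write s, t
for the counts of the greedy profiles and s' for the final bakers. Greedy selection makes s
nonincreasing along the order, the smallest-index rule then does the same for t, and the insertion
leaves the millers in equilibrium against s. The moves from s' back to s send each baker to her
first feasible location, hence never to fewer millers. Together with stability this yields, for
locations l with t(l) > 0 and l', a k with s(k)/t(k) ≤ s'(l)/t(l) and a j with s'(l')/(t(l')+1) ≤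
s(j)/(t(j)+1). The equilibrium against s compares j with k, and chaining the three inequalities
gives the one against s' (`Game.IsRun.miller_le`).

Running time. Conversely, absence of improving paths already implies maximality, by concavity of the
harmonic numbers (`Game.Stable.isPotentialMaximizer`). So a maximizer is found by repeated path
search. Each improvement gains at least 1/nb² while the potential never exceeds nm·nb, so
polynomially many sweeps suffice (`State.improve`). The program uses only counting loops bounded by
input sizes, and for such programs a polynomial time bound follows by structural induction
(`Code.exists_exec`). Only the effect of the program remains to be verified, by loop invariants
(`Code.sem_count`).

Existence. Relabel the game by initial segments of ℕ and transport the equilibrium that the program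
finds. -/

namespace BakersMillers

/-! ### Memory updates -/

namespace Memory

@[simp] theorem setReg_reg (σ : Memory) (r v q : ℕ) :
    (σ.setReg r v).reg q = if q = r then v else σ.reg q := by
  simp [setReg, Function.update_apply]

@[simp] theorem setReg_arr (σ : Memory) (r v : ℕ) : (σ.setReg r v).arr = σ.arr := rfl

@[simp] theorem setArr_reg (σ : Memory) (a i v : ℕ) : (σ.setArr a i v).reg = σ.reg := rfl

@[simp] theorem setArr_arr (σ : Memory) (a i v c j : ℕ) :
    (σ.setArr a i v).arr c j = if c = a ∧ j = i then v else σ.arr c j := by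
  by_cases hc : c = a
  · subst hc; simp [setArr, Function.update_apply]
  · simp [setArr, hc]

end Memory

/-! ### Programs with bounded loops: total semantics and polynomial time -/

/-- Programs whose only loops are counting loops with a bound `reg k + c`. -/
inductive Code where
  | skip
  | set (r : ℕ) (x : Expr)
  | store (a : ℕ) (i x : Expr)
  /-- `P` followed by `Q` -/
  | seq (P Q : Code)
  | ite (c : Expr) (P Q : Code)
  /-- for `reg r = 0, 1, …`, while it is smaller than `reg k + c`, do `P` -/
  | count (r k c : ℕ) (P : Code)

/-- `P ;; Q` is `P` followed by `Q`. -/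
infixr:50 " ;; " => Code.seq

namespace Code

/-- The underlying program. -/
def toProg : Code → Prog
  | skip => .skip
  | set r x => .set r x
  | store a i x => .store a i x
  | seq P Q => .seq P.toProg Q.toProg
  | ite c P Q => .ite c P.toProg Q.toProg
  | count r k c P => .seq (.set r (.const 0))
      (.loop (.sub (.add (.reg k) (.const c)) (.reg r))
        (.seq P.toProg (.set r (.add (.reg r) (.const 1)))))

/-- The effect of `n` rounds of a counting loop with body `f`. -/
def rounds (r : ℕ) (f : Memory → Memory) (σ : Memory) : ℕ → Memory
  | 0 => σ.setReg r 0
  | i + 1 => (f (rounds r f σ i)).setReg r (i + 1)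

/-- The effect of a program on the memory. -/
def sem : Code → Memory → Memory
  | skip, σ => σ
  | set r x, σ => σ.setReg r (x.val σ)
  | store a i x, σ => σ.setArr a (i.val σ) (x.val σ)
  | seq P Q, σ => Q.sem (P.sem σ)
  | ite c P Q, σ => if c.val σ ≠ 0 then P.sem σ else Q.sem σ
  | count r k c P, σ => rounds r P.sem σ (σ.reg k + c)

/-- The registers that a program may overwrite. -/
def regs : Code → List ℕ
  | skip => []
  | set r _ => [r]
  | store _ _ _ => []
  | seq P Q => P.regs ++ Q.regs
  | ite _ P Q => P.regs ++ Q.regs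
  | count r _ _ P => r :: P.regs

/-- The arrays that a program may overwrite. -/
def arrs : Code → List ℕ
  | skip => []
  | set _ _ => []
  | store a _ _ => [a]
  | seq P Q => P.arrs ++ Q.arrs
  | ite _ P Q => P.arrs ++ Q.arrs
  | count _ _ _ P => P.arrs

/-- The input registers are never overwritten, they bound all loops, and no loop body overwrites the
loop variable. -/
def wf : Code → Bool
  | skip => true
  | set r _ => decide (3 ≤ r)
  | store _ _ _ => true
  | seq P Q => P.wf && Q.wf
  | ite _ P Q => P.wf && Q.wf
  | count r k _ P => decide (3 ≤ r) && decide (k < 3) && decide (r ∉ P.regs) && P.wf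

theorem sem_reg {q : ℕ} : ∀ {P : Code} (σ : Memory), q ∉ P.regs → (P.sem σ).reg q = σ.reg q
  | skip, _, _ => rfl
  | set r x, σ, h => by
      simp only [regs, List.mem_singleton] at h
      simp [sem, h]
  | store _ _ _, _, _ => rfl
  | seq P Q, σ, h => by
      simp only [regs, List.mem_append, not_or] at h
      rw [sem, sem_reg _ h.2, sem_reg _ h.1]
  | ite c P Q, σ, h => by
      simp only [regs, List.mem_append, not_or] at h
      rw [sem]
      split
      · exact sem_reg _ h.1
      · exact sem_reg _ h.2
  | count r k c P, σ, h => by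
      simp only [regs, List.mem_cons, not_or] at h
      rw [sem]
      generalize σ.reg k + c = n
      induction n with
      | zero => simp [rounds, h.1]
      | succ n ih => simp only [rounds, Memory.setReg_reg, h.1, if_false]; rw [sem_reg _ h.2, ih]

theorem sem_arr {a : ℕ} : ∀ {P : Code} (σ : Memory), a ∉ P.arrs → (P.sem σ).arr a = σ.arr a
  | skip, _, _ => rfl
  | set r x, σ, _ => rfl
  | store b i x, σ, h => by
      simp only [arrs, List.mem_singleton] at h
      ext j
      simp [sem, h]
  | seq P Q, σ, h => by
      simp only [arrs, List.mem_append, not_or] at h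
      rw [sem, sem_arr _ h.2, sem_arr _ h.1]
  | ite c P Q, σ, h => by
      simp only [arrs, List.mem_append, not_or] at h
      rw [sem]
      split
      · exact sem_arr _ h.1
      · exact sem_arr _ h.2
  | count r k c P, σ, h => by
      rw [arrs] at h
      rw [sem]
      generalize σ.reg k + c = n
      induction n with
      | zero => rfl
      | succ n ih => simp only [rounds, Memory.setReg_arr]; rw [sem_arr _ h, ih]

theorem rounds_reg_self (r : ℕ) (f : Memory → Memory) (σ : Memory) (n : ℕ) :
    (rounds r f σ n).reg r = n := by
  cases n <;> simp [rounds]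

/-- Invariant rule for counting loops. -/
theorem sem_count {r k c : ℕ} {P : Code} {σ : Memory} (Inv : ℕ → Memory → Prop) {n : ℕ}
    (hn : σ.reg k + c = n) (h0 : Inv 0 (σ.setReg r 0))
    (hs : ∀ i τ, i < n → τ.reg r = i → (∀ q, q ∉ (count r k c P).regs → τ.reg q = σ.reg q) →
      (∀ a, a ∉ P.arrs → τ.arr a = σ.arr a) → Inv i τ →
      Inv (i + 1) ((P.sem τ).setReg r (i + 1))) :
    Inv n ((count r k c P).sem σ) := by
  rw [sem, hn]
  clear hn
  have key : ∀ i ≤ n, Inv i (rounds r P.sem σ i) ∧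
      (∀ q, q ∉ (count r k c P).regs → (rounds r P.sem σ i).reg q = σ.reg q) ∧
      (∀ a, a ∉ P.arrs → (rounds r P.sem σ i).arr a = σ.arr a) := by
    intro i
    induction i with
    | zero =>
      intro _
      refine ⟨h0, fun q hq => ?_, fun _ _ => rfl⟩
      simp only [regs, List.mem_cons, not_or] at hq
      simp [rounds, hq.1]
    | succ i ih =>
      intro hi
      obtain ⟨h1, h2, h3⟩ := ih (by omega)
      refine ⟨hs i _ (by omega) (rounds_reg_self _ _ _ _) h2 h3 h1, fun q hq => ?_, fun a ha => ?_⟩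
      · rw [← h2 q hq]
        simp only [regs, List.mem_cons, not_or] at hq
        simp only [rounds, Memory.setReg_reg, hq.1, if_false]
        exact sem_reg _ hq.2
      · rw [← h3 a ha]
        exact sem_arr _ ha
  exact (key n le_rfl).1

theorem notMem_regs_of_wf {q : ℕ} (hq : q < 3) : ∀ {P : Code}, P.wf = true → q ∉ P.regs
  | skip, _ => by simp [regs]
  | set r x, h => by
      simp only [wf, decide_eq_true_eq] at h
      simp only [regs, List.mem_singleton]
      omega
  | store _ _ _, _ => by simp [regs]
  | seq P Q, h => by
      simp only [wf, Bool.and_eq_true] at h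
      simp [regs, notMem_regs_of_wf hq h.1, notMem_regs_of_wf hq h.2]
  | ite _ P Q, h => by
      simp only [wf, Bool.and_eq_true] at h
      simp [regs, notMem_regs_of_wf hq h.1, notMem_regs_of_wf hq h.2]
  | count r k c P, h => by
      simp only [wf, Bool.and_eq_true, decide_eq_true_eq] at h
      simp only [regs, List.mem_cons, not_or]
      exact ⟨by omega, notMem_regs_of_wf hq h.2⟩

/-- The size of the input. -/
def size (σ : Memory) : ℕ := σ.reg 0 + σ.reg 1 + σ.reg 2

theorem size_sem {P : Code} (h : P.wf = true) (σ : Memory) : size (P.sem σ) = size σ := by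
  simp only [size]
  rw [sem_reg _ (notMem_regs_of_wf (by norm_num) h), sem_reg _ (notMem_regs_of_wf (by norm_num) h),
    sem_reg _ (notMem_regs_of_wf (by norm_num) h)]

/-- Induction on the number `d` of remaining rounds. The body preserves the input registers, so the
loop bound stays fixed and `T` bounds every run of the body; guard and increment cost 10 more per
round. -/
theorem exec_loop {r k c : ℕ} {P : Code} (hr : 3 ≤ r) (hk : k < 3) (hrP : r ∉ P.regs)
    (hP : P.wf = true) (σ : Memory) (T : ℕ)
    (hT : ∀ τ, size τ = size σ → ∃ n, Exec P.toProg τ n (P.sem τ) ∧ n ≤ T) (d : ℕ) :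
    ∀ i, i + d = σ.reg k + c → ∃ n,
      Exec (.loop (.sub (.add (.reg k) (.const c)) (.reg r))
        (.seq P.toProg (.set r (.add (.reg r) (.const 1))))) (rounds r P.sem σ i) n
        (rounds r P.sem σ (σ.reg k + c)) ∧ n ≤ d * (T + 10) + 10 := by
  have hreg : ∀ q < 3, ∀ i, (rounds r P.sem σ i).reg q = σ.reg q := by
    intro q hq i
    have hqr : q ≠ r := by omega
    induction i with
    | zero => simp [rounds, hqr]
    | succ i ih =>
      simp only [rounds, Memory.setReg_reg, hqr, if_false]
      rw [sem_reg _ (notMem_regs_of_wf hq hP), ih]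
  have hsize : ∀ i, size (rounds r P.sem σ i) = size σ := by
    intro i
    simp only [size]
    rw [hreg 0 (by norm_num), hreg 1 (by norm_num), hreg 2 (by norm_num)]
  induction d with
  | zero =>
    intro i hi
    obtain rfl : i = σ.reg k + c := by omega
    refine ⟨_, Exec.loop_false ?_, by simp [Expr.cost]⟩
    simp [Expr.val, rounds_reg_self, hreg k hk]
  | succ d ih =>
    intro i hi
    obtain ⟨m, hm, hmT⟩ := hT _ (hsize i)
    obtain ⟨n, hn, hnT⟩ := ih (i + 1) (by omega)
    have hr1 : ((P.sem (rounds r P.sem σ i)).setReg r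
        ((Expr.add (.reg r) (.const 1)).val (P.sem (rounds r P.sem σ i)))) =
        rounds r P.sem σ (i + 1) := by
      simp [rounds, Expr.val, sem_reg _ hrP, rounds_reg_self]
    rw [← hr1] at hn
    refine ⟨_, Exec.loop_true ?_ (Exec.seq hm (Exec.set _ _ _)) hn, ?_⟩
    · simp only [Expr.val, rounds_reg_self, hreg k hk]
      omega
    · simp only [Expr.cost]
      ring_nf at hnT ⊢
      omega

/-- Every well-formed program runs in polynomial time. -/
theorem exists_exec : ∀ {P : Code}, P.wf = true → ∃ f : Polynomial ℕ, ∀ σ, ∃ n,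
    Exec P.toProg σ n (P.sem σ) ∧ n ≤ f.eval (size σ)
  | skip, _ => ⟨.C 1, fun σ => ⟨_, Exec.skip σ, by simp⟩⟩
  | set r x, _ => ⟨.C (x.cost + 1), fun σ => ⟨_, Exec.set σ r x, by simp⟩⟩
  | store a i x, _ => ⟨.C (i.cost + x.cost + 1), fun σ => ⟨_, Exec.store σ a i x, by simp⟩⟩
  | seq P Q, h => by
      simp only [wf, Bool.and_eq_true] at h
      obtain ⟨f, hf⟩ := exists_exec h.1
      obtain ⟨g, hg⟩ := exists_exec h.2
      refine ⟨f + g, fun σ => ?_⟩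
      obtain ⟨m, hm, hm'⟩ := hf σ
      obtain ⟨n, hn, hn'⟩ := hg (P.sem σ)
      rw [size_sem h.1] at hn'
      exact ⟨_, Exec.seq hm hn, by rw [Polynomial.eval_add]; omega⟩
  | ite c P Q, h => by
      simp only [wf, Bool.and_eq_true] at h
      obtain ⟨f, hf⟩ := exists_exec h.1
      obtain ⟨g, hg⟩ := exists_exec h.2
      refine ⟨.C (c.cost + 1) + f + g, fun σ => ?_⟩
      obtain ⟨m, hm, hm'⟩ := hf σ
      obtain ⟨n, hn, hn'⟩ := hg σ
      simp only [Polynomial.eval_add, Polynomial.eval_C, sem]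
      split
      · next hc => exact ⟨_, Exec.ite_true hc hm, by omega⟩
      · next hc => exact ⟨_, Exec.ite_false (not_not.1 hc) hn, by omega⟩
  | count r k c P, h => by
      simp only [wf, Bool.and_eq_true, decide_eq_true_eq] at h
      obtain ⟨⟨⟨hr, hk⟩, hrP⟩, hP⟩ := h
      obtain ⟨f, hf⟩ := exists_exec hP
      -- At most `size + c` rounds, since the bound is an input register plus `c`. The 12 covers the
      -- initial assignment (2 steps) and the slack of 10 in `exec_loop`.
      refine ⟨(.X + .C c) * (f + .C 10) + .C 12, fun σ => ?_⟩
      obtain ⟨n, hn, hn'⟩ := exec_loop (c := c) hr hk hrP hP σ (f.eval (size σ))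
        (fun τ hτ => by rw [← hτ]; exact hf τ) (σ.reg k + c) 0 (by omega)
      refine ⟨_, Exec.seq (Exec.set _ _ _) hn, ?_⟩
      have hks : σ.reg k ≤ size σ := by
        simp only [size]
        interval_cases k <;> omega
      have : (σ.reg k + c) * (f.eval (size σ) + 10) ≤ (size σ + c) * (f.eval (size σ) + 10) :=
        Nat.mul_le_mul_right _ (by omega)
      simp only [Expr.cost, Polynomial.eval_add, Polynomial.eval_mul, Polynomial.eval_X,
        Polynomial.eval_C]
      omega

end Code

/-! ### Occupation numbers and shifts of one agent -/

section Count

variable {A L : Type*} [Fintype A] [DecidableEq L]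

/-- Both corrections are added rather than subtracted, so truncation plays no role and `l = x b` is
no special case. -/
theorem count_update [DecidableEq A] (x : A → L) (b : A) (l m : L) :
    count (Function.update x b l) m + (if m = x b then 1 else 0) =
      count x m + if m = l then 1 else 0 := by
  simp only [count, Finset.card_filter]
  rw [← Finset.add_sum_erase _ _ (Finset.mem_univ b),
    ← Finset.add_sum_erase _ (fun a => if x a = m then 1 else 0) (Finset.mem_univ b)]
  have h : ∑ a ∈ Finset.univ.erase b, (if Function.update x b l a = m then 1 else 0) =
      ∑ a ∈ Finset.univ.erase b, if x a = m then 1 else 0 :=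
    Finset.sum_congr rfl fun a ha => by rw [Function.update_of_ne (Finset.ne_of_mem_erase ha)]
  rw [h]
  simp only [Function.update_self, eq_comm (a := m)]
  omega

theorem count_le_card (x : A → L) (l : L) : count x l ≤ Fintype.card A := Finset.card_le_univ _

theorem sum_count (x : A → L) (R : Finset L) :
    ∑ l ∈ R, count x l = (Finset.univ.filter fun a => x a ∈ R).card :=
  Finset.sum_card_fiberwise_eq_card_filter _ _ _

theorem sum_count_univ [Fintype L] (x : A → L) : ∑ l, count x l = Fintype.card A := by
  rw [sum_count]; simp

theorem count_pos {x : A → L} (a : A) : 0 < count x (x a) :=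
  Finset.card_pos.2 ⟨a, by simp⟩

theorem exists_of_count_pos {x : A → L} {l : L} (h : 0 < count x l) : ∃ a, x a = l := by
  obtain ⟨a, ha⟩ := Finset.card_pos.1 h
  exact ⟨a, by simpa using ha⟩

/-- Pigeonhole: in total, `x` has at least as many agents in `R` as `y`, so a deficit at `l` is
compensated elsewhere in `R`. -/
theorem exists_count_lt [Fintype L] {x y : A → L} (R : Set L) (h : ∀ a, y a ∈ R → x a ∈ R) {l : L}
    (hl : l ∈ R) (hlt : count x l < count y l) : ∃ k ∈ R, count y k < count x k := by
  classical
  by_contra! hc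
  have h1 : ∑ k ∈ R.toFinset, count x k < ∑ k ∈ R.toFinset, count y k :=
    Finset.sum_lt_sum (fun k hk => hc k (by simpa using hk)) ⟨l, by simpa using hl, hlt⟩
  rw [sum_count, sum_count] at h1
  refine absurd h1 (not_lt.2 (Finset.card_le_card fun a => ?_))
  simpa using h a

/-- The counts of `x'` arise from those of `x` by moving one agent from `a` to `c`. -/
def Shift (x x' : A → L) (a c : L) : Prop :=
  ∀ m, count x' m + (if m = a then 1 else 0) = count x m + if m = c then 1 else 0

theorem Shift.refl (x : A → L) (a : L) : Shift x x a a := fun _ => rfl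

theorem Shift.trans {x y z : A → L} {a b c : L} (h : Shift x y a b) (h' : Shift y z b c) :
    Shift x z a c := fun m => by have := h m; have := h' m; omega

theorem shift_update [DecidableEq A] (x : A → L) (b : A) (l : L) :
    Shift x (Function.update x b l) (x b) l := count_update x b l

end Count

/-! ### Concavity of harmonic numbers and changes of the potential -/

/-- A concave sequence lies below every line through its point at `n` whose slope is between the
next increment `w / (n + 1)` and the last one `w / n`. The upper bound on `p` is multiplied out, so
it is harmless at `n = 0`. -/
theorem harmonic_tangent {w p : ℚ} {n : ℕ} (h1 : w / (n + 1) ≤ p) (h2 : p * n ≤ w) (hw : 0 ≤ w)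
    (m : ℕ) : w * harmonic m ≤ w * harmonic n + p * ((m : ℚ) - n) := by
  rcases le_total n m with h | h
  · induction m, h using Nat.le_induction with
    | base => simp
    | succ m hm ih =>
      rw [harmonic_succ]
      have hnm : (n : ℚ) ≤ m := by exact_mod_cast hm
      have : w * ((m + 1 : ℕ) : ℚ)⁻¹ ≤ p := by
        refine le_trans ?_ h1
        rw [← div_eq_mul_inv]
        push_cast
        gcongr
      push_cast at this ⊢
      linarith
  · cases n with
    | zero => simp [Nat.le_zero.1 h]
    | succ n =>
      have hp : p ≤ w / (n + 1) := by
        rw [le_div_iff₀ (by positivity)]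
        simpa using h2
      have key : ∀ k, m ≤ k → k ≤ n + 1 → w * harmonic m + p * ((k : ℚ) - m) ≤ w * harmonic k := by
        intro k hk
        induction k, hk using Nat.le_induction with
        | base => simp
        | succ k hk ih =>
          intro hkn
          have := ih (by omega)
          rw [harmonic_succ]
          have hkn' : (k : ℚ) ≤ n := by exact_mod_cast (by omega : k ≤ n)
          have hpk : p ≤ w * ((k + 1 : ℕ) : ℚ)⁻¹ := by
            rw [← div_eq_mul_inv]
            refine hp.trans ?_
            push_cast
            gcongr
          push_cast at hpk ⊢
          linarith
      have := key (n + 1) (by omega) le_rfl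
      push_cast at this ⊢
      linarith

theorem harmonic_le_self (n : ℕ) : harmonic n ≤ n := by
  have := harmonic_tangent (w := 1) (p := 1) (n := 0) (by simp) (by simp) (by simp) n
  simpa using this

section Potential

variable {B M L : Type*} [Fintype B] [Fintype M] [Fintype L] [DecidableEq L]

theorem potential_nonneg (t : M → L) (x : B → L) : 0 ≤ potential t x :=
  Finset.sum_nonneg fun l _ => mul_nonneg (by positivity)
    (by rw [harmonic]; exact Finset.sum_nonneg fun i _ => by positivity)

theorem potential_le (t : M → L) (x : B → L) :
    potential t x ≤ Fintype.card M * Fintype.card B := by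
  rw [← sum_count_univ t, Nat.cast_sum, Finset.sum_mul]
  refine Finset.sum_le_sum fun l _ => mul_le_mul_of_nonneg_left ?_ (by positivity)
  exact (harmonic_le_self _).trans (by exact_mod_cast count_le_card x l)

/-- All terms cancel except one harmonic increment at `c` and one decrement at `a`. -/
theorem potential_shift (t : M → L) {x x' : B → L} {a c : L} (h : Shift x x' a c) (hac : a ≠ c) :
    potential t x' =
      potential t x + ((count t c : ℚ) / (count x c + 1) - (count t a : ℚ) / count x a) := by
  rw [← sub_eq_iff_eq_add', potential, potential, ← Finset.sum_sub_distrib]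
  have : ∀ l, (count t l : ℚ) * harmonic (count x' l) - count t l * harmonic (count x l) =
      (if l = c then (count t c : ℚ) / (count x c + 1) else 0) -
        if l = a then (count t a : ℚ) / count x a else 0 := by
    intro l
    have hl := h l
    by_cases h1 : l = a
    · subst h1
      simp only [if_true, hac, if_false] at hl ⊢
      have hl' : count x l = count x' l + 1 := by omega
      rw [hl', harmonic_succ]
      push_cast
      ring
    · by_cases h2 : l = c
      · subst h2
        simp only [if_true, h1, if_false] at hl ⊢
        have hl' : count x' l = count x l + 1 := by omega
        rw [hl', harmonic_succ]
        push_cast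
        ring
      · simp only [h1, h2, if_false, add_zero] at hl ⊢
        rw [hl]
        ring
  rw [Finset.sum_congr rfl fun l _ => this l, Finset.sum_sub_distrib]
  simp

/-- The gain is a positive fraction whose integral numerator is at least 1 and whose denominator is
a product of two factors, each at most the number of bakers. -/
theorem potential_add_le (t : M → L) {x x' : B → L} {a c : L} (h : Shift x x' a c)
    (hlt : count t a * (count x c + 1) < count t c * count x a) :
    potential t x + 1 / (Fintype.card B : ℚ) ^ 2 ≤ potential t x' := by
  have hac : a ≠ c := by
    rintro rfl
    exact absurd hlt (not_lt.2 (Nat.mul_le_mul_left _ (Nat.le_succ _)))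
  have ha : 0 < count x a := Nat.pos_of_ne_zero fun h0 => by rw [h0] at hlt; omega
  have hsum : count x a + count x c ≤ Fintype.card B := by
    rw [← sum_count_univ x, ← Finset.sum_pair hac]
    exact Finset.sum_le_sum_of_subset (Finset.subset_univ _)
  rw [potential_shift t h hac]
  have h1 : (0 : ℚ) < count x a := by exact_mod_cast ha
  have h2 : (0 : ℚ) < (count x c : ℚ) + 1 := by positivity
  have h3 : (count x a : ℚ) ≤ Fintype.card B := by exact_mod_cast (by omega)
  -- A baker at `a ≠ c` leaves room for the extra 1.
  have h4 : (count x c : ℚ) + 1 ≤ Fintype.card B := by exact_mod_cast (by omega)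
  have h5 : (count t a : ℚ) * (count x c + 1) + 1 ≤ count t c * count x a := by exact_mod_cast hlt
  rw [div_sub_div _ _ h2.ne' h1.ne']
  gcongr
  · nlinarith
  · nlinarith
  · rw [sq]
    gcongr

end Potential

/-! ### Paths of feasible moves and the greedy profile -/

namespace Game

variable {B M L : Type*} [Fintype B] [DecidableEq L]

/-- Some baker at `a` may move to `l`. -/
def Edge (G : Game B M L) (x : B → L) (a l : L) : Prop := ∃ b, x b = a ∧ l ∈ G.feas b

/-- The locations from which `c` is reached by at most `n` edges. -/
def within (G : Game B M L) (x : B → L) (c : L) : ℕ → Set L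
  | 0 => {c}
  | n + 1 => {a | a ∈ G.within x c n ∨ ∃ l ∈ G.within x c n, G.Edge x a l}

/-- The layers make the path shortest, so the bakers moved along it start at distinct locations. The
last clause records this: a baker outside layer `n` is untouched by the moves inside it, and can
still make the first move of a longer path. -/
theorem exists_shift_of_within [DecidableEq B] (G : Game B M L) {x : B → L} (hx : G.Feasible x)
    (c : L) (n : ℕ) : ∀ a ∈ G.within x c n, ∃ x', G.Feasible x' ∧ Shift x x' a c ∧
      ∀ b, x b ∉ G.within x c n → x' b = x b := by
  induction n with
  | zero =>
    rintro a rfl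
    exact ⟨x, hx, Shift.refl x a, fun _ _ => rfl⟩
  | succ n ih =>
    intro a ha
    by_cases han : a ∈ G.within x c n
    · obtain ⟨x', h1, h2, h3⟩ := ih a han
      exact ⟨x', h1, h2, fun b hb => h3 b fun h => hb (Or.inl h)⟩
    · obtain ha | ⟨l, hl, b, rfl, hb⟩ := ha
      · exact absurd ha han
      obtain ⟨x', h1, h2, h3⟩ := ih l hl
      refine ⟨Function.update x' b l, fun b' => ?_, ?_, fun b' hb' => ?_⟩
      · by_cases h : b' = b
        · subst h; simpa using hb
        · simpa [h] using h1 b'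
      · have h4 := shift_update x' b l
        rw [h3 b han] at h4
        intro m
        have := h4 m
        have := h2 m
        omega
      · have hne : b' ≠ b := by
          rintro rfl
          exact hb' (Or.inr ⟨l, hl, b', rfl, hb⟩)
        rw [Function.update_of_ne hne]
        exact h3 b' fun h => hb' (Or.inl h)

theorem exists_shift (G : Game B M L) {x : B → L} (hx : G.Feasible x) {a c : L}
    (h : Relation.ReflTransGen (G.Edge x) a c) : ∃ x', G.Feasible x' ∧ Shift x x' a c := by
  classical
  have : ∃ n, a ∈ G.within x c n := by
    induction h using Relation.ReflTransGen.head_induction_on with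
    | refl => exact ⟨0, rfl⟩
    | head hab _ ih =>
      obtain ⟨n, hn⟩ := ih
      exact ⟨n + 1, Or.inr ⟨_, hn, hab⟩⟩
  obtain ⟨n, hn⟩ := this
  obtain ⟨x', h1, h2, -⟩ := G.exists_shift_of_within hx c n a hn
  exact ⟨x', h1, h2⟩

section Greedy

variable {p : ℕ} {G : Game B M L} {ord : Fin p ≃ L} {s : B → L}

/-- A baker is assigned in the round of the first location feasible for her; later locations play no
role. -/
theorem IsGreedyAssignment.spec (h : G.IsGreedyAssignment ord s) (b : B) :
    s b ∈ G.feas b ∧ ∀ j, ord j ∈ G.feas b → ord.symm (s b) ≤ j := by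
  obtain ⟨l, hl⟩ := G.feas_nonempty b
  obtain ⟨i, hi, hmin⟩ := Finset.exists_min_image (Finset.univ.filter fun j => ord j ∈ G.feas b) id
    ⟨ord.symm l, by simpa using hl⟩
  simp only [Finset.mem_filter, Finset.mem_univ, true_and, id] at hi hmin
  have hs : s b = ord i := h i b (by
    simp only [unassigned, Finset.mem_filter, Finset.mem_univ, true_and]
    exact fun j hj hf => absurd (hmin j hf) (not_le.2 hj)) hi
  rw [hs]
  exact ⟨hi, fun j hj => by simpa using hmin j hj⟩

theorem IsGreedyAssignment.count_eq (h : G.IsGreedyAssignment ord s) (i : Fin p) :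
    count s (ord i) = G.inRange ord i (ord i) := by
  rw [count, inRange, unassigned, Finset.filter_filter]
  congr 1
  ext b
  simp only [Finset.mem_filter, Finset.mem_univ, true_and]
  constructor
  · intro hb
    have := h.spec b
    rw [hb] at this
    refine ⟨fun j hj hf => absurd (this.2 j hf) ?_, this.1⟩
    simpa using hj
  · rintro ⟨h1, h2⟩
    exact h i b (by simpa [unassigned] using h1) h2

/-- In round `i` the location `ord j` was available and had at least as many unassigned bakers in
range as in the later round `j`, yet `ord i` was preferred. -/
theorem IsGreedyOrder.count_antitone (ho : G.IsGreedyOrder ord) (h : G.IsGreedyAssignment ord s)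
    {i j : Fin p} (hij : i ≤ j) : count s (ord j) ≤ count s (ord i) := by
  rw [h.count_eq, h.count_eq]
  refine le_trans (Finset.card_le_card (Finset.filter_subset_filter _ fun b => ?_)) (ho i j hij)
  simp only [unassigned, Finset.mem_filter, Finset.mem_univ, true_and]
  exact fun hb k hk => hb k (hk.trans_le hij)

end Greedy

/-! ### Potential maximizers are the path-stable profiles -/

variable [Fintype M]

/-- No sequence of moves along edges improves the potential. -/
def Stable (G : Game B M L) (t : M → L) (x : B → L) : Prop :=
  ∀ a c, Relation.ReflTransGen (G.Edge x) a c →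
    count t c * count x a ≤ count t a * (count x c + 1)

theorem IsPotentialMaximizer.stable [Fintype L] {G : Game B M L} {t : M → L} {x : B → L}
    (h : G.IsPotentialMaximizer t x) : G.Stable t x := by
  intro a c hac
  by_contra! hlt
  obtain ⟨x', hx', hs⟩ := G.exists_shift h.1 hac
  have h1 := potential_add_le t hs hlt
  have h2 := h.2 x' hx'
  have ha : 0 < count x a := Nat.pos_of_ne_zero fun h0 => by rw [h0] at hlt; omega
  obtain ⟨b, -⟩ := exists_of_count_pos ha
  have : 0 < (Fintype.card B : ℚ) := by exact_mod_cast Fintype.card_pos_iff.2 ⟨b⟩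
  have : 0 < 1 / (Fintype.card B : ℚ) ^ 2 := by positivity
  linarith

/-- A duality argument. Give each location the price `v (c l)`, the best marginal value reachable
from it. Stability places this price between the next and the last marginal value at `l`, so the
potential lies below its linearization with these prices. Moving a baker from `x b` to `y b` follows
an edge, along which prices do not rise; hence the linear term is nonpositive. -/
theorem Stable.isPotentialMaximizer [Fintype L] {G : Game B M L} {t : M → L} {x : B → L}
    (hx : G.Feasible x) (h : G.Stable t x) : G.IsPotentialMaximizer t x := by
  classical
  refine ⟨hx, fun y hy => ?_⟩
  set v : L → ℚ := fun c => (count t c : ℚ) / (count x c + 1) with hv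
  have hp : ∀ a, ∃ c, Relation.ReflTransGen (G.Edge x) a c ∧
      ∀ c', Relation.ReflTransGen (G.Edge x) a c' → v c' ≤ v c := by
    intro a
    obtain ⟨c, hc, hc'⟩ := Finset.exists_max_image
      (Finset.univ.filter fun c => Relation.ReflTransGen (G.Edge x) a c) v
      ⟨a, by simpa using Relation.ReflTransGen.refl⟩
    exact ⟨c, by simpa using hc, fun c' h' => hc' c' (by simpa using h')⟩
  choose c hc hc' using hp
  have hmono : ∀ b, v (c (y b)) ≤ v (c (x b)) := fun b =>
    hc' _ _ (Relation.ReflTransGen.head ⟨b, rfl, hy b⟩ (hc (y b)))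
  have hsum : ∀ z : B → L, ∑ l, v (c l) * (count z l : ℚ) = ∑ b, v (c (z b)) := by
    intro z
    simp only [count, Finset.card_filter, Nat.cast_sum, Finset.mul_sum]
    rw [Finset.sum_comm]
    simp
  -- The trivial path gives the lower bound on the slope, stability along the path from `l` to `c l`
  -- the upper one.
  have h1 : potential t y ≤ potential t x + ∑ l, v (c l) * ((count y l : ℚ) - count x l) := by
    rw [potential, potential, ← Finset.sum_add_distrib]
    refine Finset.sum_le_sum fun l _ => harmonic_tangent ?_ ?_ (by positivity) _
    · exact hc' l l .refl
    · have := h l (c l) (hc l)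
      rw [hv]
      simp only
      rw [div_mul_eq_mul_div, div_le_iff₀ (by positivity)]
      exact_mod_cast this
  have h2 : ∑ l, v (c l) * ((count y l : ℚ) - count x l) ≤ 0 := by
    simp only [mul_sub, Finset.sum_sub_distrib, hsum]
    exact sub_nonpos.2 (Finset.sum_le_sum fun b _ => hmono b)
  linarith

/-! ### Equilibrium of the millers after the bakers are reassigned -/

section Run

variable {p q : ℕ} {G : Game B M L} {ord : Fin p ≃ L} {s : B → L} {e : Fin q ≃ M} {t : M → L}

theorem placed_le_count (k : Fin q) (l : L) : placed e t k l ≤ count t l := by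
  refine Finset.card_le_card_of_injOn e (fun j hj => ?_) e.injective.injOn
  simp only [Finset.coe_filter, Finset.mem_univ, true_and, Set.mem_ofPred_eq] at hj ⊢
  exact hj.2

theorem exists_last_placed (e : Fin q ≃ M) {l : L} (h : 0 < count t l) :
    ∃ k, t (e k) = l ∧ count t l ≤ placed e t k l + 1 := by
  obtain ⟨m, hm⟩ := exists_of_count_pos h
  obtain ⟨k, hk, hmax⟩ := Finset.exists_max_image (Finset.univ.filter fun j => t (e j) = l) id
    ⟨e.symm m, by simpa using hm⟩
  simp only [Finset.mem_filter, Finset.mem_univ, true_and, id] at hk hmax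
  refine ⟨k, hk, ?_⟩
  have : count t l ≤
      (insert k (Finset.univ.filter fun j => j < k ∧ t (e j) = l)).card := by
    refine Finset.card_le_card_of_injOn e.symm (fun m hm => ?_) e.symm.injective.injOn
    simp only [Finset.coe_filter, Finset.mem_univ, true_and, Set.mem_ofPred_eq] at hm
    have := hmax (e.symm m) (by simpa using hm)
    rcases this.eq_or_lt with h | h
    · simp [h]
    · simp [h, hm]
  exact this.trans (Finset.card_insert_le _ _)

/-- The last miller inserted at `l` preferred it to `l'`. From then on the count at `l` is final,
while that at `l'` can only grow. -/
theorem IsInsertion.miller (h : IsInsertion ord s e t) {l : L} (hl : 0 < count t l) (l' : L) :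
    count s l' * count t l ≤ count s l * (count t l' + 1) := by
  obtain ⟨k, hk, hk'⟩ := exists_last_placed e hl
  obtain ⟨i, hi, hmax, -⟩ := h k
  have := hmax (ord.symm l')
  rw [← hi, hk, Equiv.apply_symm_apply, insertionValue, insertionValue,
    div_le_div_iff₀ (by positivity) (by positivity)] at this
  have h1 : count s l' * (placed e t k l + 1) ≤ count s l * (placed e t k l' + 1) := by
    exact_mod_cast this
  exact (Nat.mul_le_mul_left _ hk').trans (h1.trans
    (Nat.mul_le_mul_left _ (Nat.succ_le_succ (placed_le_count k l'))))

/-- If the later location ended with more millers, consider the last one inserted there: the earlier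
location then had at least as many bakers and no more millers, so the tie-breaking rule would have
preferred it. -/
theorem IsInsertion.count_antitone (h : IsInsertion ord s e t)
    (hs : ∀ i j, i ≤ j → count s (ord j) ≤ count s (ord i)) {i j : Fin p} (hij : i ≤ j) :
    count t (ord j) ≤ count t (ord i) := by
  by_contra! hlt
  have hne : i < j := hij.lt_of_ne (by rintro rfl; exact lt_irrefl _ hlt)
  obtain ⟨k, hk, hk'⟩ := exists_last_placed e (Nat.zero_lt_of_lt hlt)
  obtain ⟨j', hj', -, hstrict⟩ := h k
  obtain rfl : j = j' := ord.injective (hk.symm.trans hj')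
  refine absurd (hstrict i hne) (not_lt.2 ?_)
  have h1 := placed_le_count (e := e) (t := t) k (ord i)
  have h2 : ((placed e t k (ord i) : ℕ) : ℚ) ≤ placed e t k (ord j) := by
    exact_mod_cast (by omega : placed e t k (ord i) ≤ placed e t k (ord j))
  have h3 : ((count s (ord j) : ℕ) : ℚ) ≤ count s (ord i) := by exact_mod_cast hs i j hij
  rw [insertionValue, insertionValue]
  gcongr

theorem IsRun.miller_le [Fintype L] {s' : B → L} (h : G.IsRun ord s e t s') {l : L}
    (hl : 0 < count t l) (l' : L) :
    count s' l' * count t l ≤ count s' l * (count t l' + 1) := by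
  classical
  obtain ⟨ho, ha, hi, hm⟩ := h
  have hst := hm.stable
  have hS : ∀ i j, i ≤ j → count s (ord j) ≤ count s (ord i) := fun i j => ho.count_antitone ha
  have hT : ∀ a c, ord.symm a ≤ ord.symm c → count t c ≤ count t a := fun a c hac => by
    simpa using hi.count_antitone hS hac
  -- the moves that lead from `s'` back to `s`
  let D : L → L → Prop := fun a c => ∃ b, s' b = a ∧ s b = c
  have hDE : ∀ a c, Relation.ReflTransGen D a c → Relation.ReflTransGen (G.Edge s') a c :=
    fun a c hac => 
      Relation.ReflTransGen.mono (fun _ _ ⟨b, h1, h2⟩ => ⟨b, h1, h2 ▸ (ha.spec b).1⟩) _ _ hac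
  -- `s b` is the first location feasible for `b`, so it precedes `s' b` in the order, and millers
  -- are nonincreasing along the order.
  have hDT : ∀ a c, Relation.ReflTransGen D a c → count t a ≤ count t c := by
    intro a c hac
    induction hac with
    | refl => exact le_rfl
    | tail _ hbc ih =>
      obtain ⟨b, h1, h2⟩ := hbc
      refine ih.trans (hT _ _ ?_)
      rw [← h2]
      exact (ha.spec b).2 _ (by simpa [h1] using hm.1 b)
  -- In ratios: s(k)/t(k) ≤ s'(l)/t(l). If `l` loses bakers in passing from `s` to `s'`, pigeonhole
  -- on the locations leading to `l` finds `k` that gains some, and stability along the path from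
  -- `k` to `l` compares the two.
  have hA : ∃ k, 0 < count t k ∧ count s k * count t l ≤ count s' l * count t k := by
    rcases le_or_gt (count s l) (count s' l) with hle | hlt
    · exact ⟨l, hl, Nat.mul_le_mul_right _ hle⟩
    obtain ⟨k, hk, hlk⟩ := exists_count_lt (x := s') (y := s)
      {k | Relation.ReflTransGen D k l} (fun b hb => .head ⟨b, rfl, rfl⟩ hb) .refl hlt
    have h1 := hst k l (hDE _ _ hk)
    have h2 := hDT _ _ hk
    refine ⟨k, Nat.pos_of_ne_zero fun h0 => ?_, ?_⟩
    · rw [h0] at h1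
      have := Nat.mul_pos hl (Nat.zero_lt_of_lt hlk)
      omega
    · have h3 : count t l * (count s k + 1) ≤ count t l * count s' k := Nat.mul_le_mul_left _ hlk
      nlinarith
  -- In ratios: s'(l')/(t(l')+1) ≤ s(j)/(t(j)+1). With millers at `l'` the argument is dual to the
  -- previous one, using the locations reached from `l'`.
  have hB : ∃ j, count s' l' * (count t j + 1) ≤ count s j * (count t l' + 1) := by
    rcases Nat.eq_zero_or_pos (count t l') with h0 | hpos
    -- Without millers at `l'`, take the first location `ord k` without millers. By stability no
    -- baker at `l'` may move to a location with millers, so all of them are still unassigned in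
    -- round `k` with `l'` in range, and the greedy choice made `ord k` at least as popular.
    · obtain ⟨k, hk, hmin⟩ := Finset.exists_min_image
        (Finset.univ.filter fun j => count t (ord j) = 0) id ⟨ord.symm l', by simpa using h0⟩
      simp only [Finset.mem_filter, Finset.mem_univ, true_and, id] at hk hmin
      refine ⟨ord k, ?_⟩
      rw [hk, h0, Nat.mul_one, Nat.mul_one, ha.count_eq]
      refine le_trans ?_ (ho k (ord.symm l') (hmin _ (by simpa using h0)))
      rw [Equiv.apply_symm_apply]
      refine Finset.card_le_card fun b hb => ?_
      simp only [unassigned, Finset.mem_filter, Finset.mem_univ, true_and] at hb ⊢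
      refine ⟨fun j hj hf => ?_, hb ▸ hm.1 b⟩
      have h1 := hst l' (ord j) (.single ⟨b, hb, hf⟩)
      rw [h0, Nat.zero_mul, Nat.le_zero, Nat.mul_eq_zero] at h1
      rcases h1 with h1 | h1
      · exact absurd (hmin j h1) (not_le.2 hj)
      · have := count_pos (x := s') b
        rw [hb] at this
        omega
    · rcases le_or_gt (count s' l') (count s l') with hle | hlt
      · exact ⟨l', Nat.mul_le_mul_right _ hle⟩
      obtain ⟨k, hk, hlk⟩ := exists_count_lt (x := s) (y := s')
        {k | Relation.ReflTransGen D l' k} (fun b hb => .tail hb ⟨b, rfl, rfl⟩) .refl hlt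
      have h1 := hst l' k (hDE _ _ hk)
      have h2 := hDT _ _ hk
      have h3 : count t l' * (count s' k + 1) ≤ count t l' * count s k :=
        Nat.mul_le_mul_left _ hlk
      have h4 : count t l' * count s k ≤ count t k * count s k := Nat.mul_le_mul_right _ h2
      have h5 : count s' l' ≤ count s k :=
        Nat.le_of_mul_le_mul_left (h1.trans (h3.trans h4)) (hpos.trans_le h2)
      exact ⟨k, by nlinarith⟩
  obtain ⟨k, hk, hA⟩ := hA
  obtain ⟨j, hB⟩ := hB
  have hC := hi.miller hk j
  -- The three fractional inequalities are multiplied and the common positive factor is cancelled.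
  refine Nat.le_of_mul_le_mul_right (c := (count t j + 1) * count t k) ?_ (by positivity)
  calc count s' l' * count t l * ((count t j + 1) * count t k)
      = count s' l' * (count t j + 1) * (count t l * count t k) := by ring
    _ ≤ count s j * (count t l' + 1) * (count t l * count t k) := Nat.mul_le_mul_right _ hB
    _ = count s j * count t k * ((count t l' + 1) * count t l) := by ring
    _ ≤ count s k * (count t j + 1) * ((count t l' + 1) * count t l) := Nat.mul_le_mul_right _ hC
    _ = count s k * count t l * ((count t j + 1) * (count t l' + 1)) := by ring
    _ ≤ count s' l * count t k * ((count t j + 1) * (count t l' + 1)) := Nat.mul_le_mul_right _ hA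
    _ = count s' l * (count t l' + 1) * ((count t j + 1) * count t k) := by ring

theorem count_update_self {A : Type*} [Fintype A] [DecidableEq A] {x : A → L} {a : A} {l : L}
    (h : l ≠ x a) : count (Function.update x a l) l = count x l + 1 := by
  simpa [h] using count_update x a l l

theorem IsRun.isPureNash [Fintype L] [DecidableEq B] [DecidableEq M] {s' : B → L}
    (h : G.IsRun ord s e t s') : G.IsPureNash s' t := by
  refine ⟨h.maximizer.1, fun b l hl => not_lt.2 ?_, fun m l => not_lt.2 ?_⟩
  · by_cases hb : l = s' b
    · rw [hb, Function.update_eq_self]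
    have h1 := h.maximizer.stable (s' b) l (.single ⟨b, rfl, hl⟩)
    have h2 := count_pos (x := s') b
    rw [bakerUtility, bakerUtility, Function.update_self, count_update_self hb,
      div_le_div_iff₀ (by positivity) (by positivity)]
    exact_mod_cast h1
  · by_cases hm : l = t m
    · rw [hm, Function.update_eq_self]
    have h2 := count_pos (x := t) m
    have h1 := h.miller_le h2 l
    rw [millerUtility, millerUtility, Function.update_self, count_update_self hm,
      div_le_div_iff₀ (by positivity) (by positivity)]
    exact_mod_cast h1

end Run

end Game

/-! ### The program -/

/-- The feasibility bit of the baker in register `b` and the location in register `l`. -/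
def feasBit (b l : ℕ) : Expr := .get 0 (.add (.get 5 (.reg b)) (.reg l))

/-- Array 5 gets the positions where the rows of the matrix begin. -/
def rowStarts : Code :=
  .set 3 (.const 0) ;;
  .count 4 0 0 (.store 5 (.reg 4) (.reg 3) ;; .set 3 (.add (.reg 3) (.reg 2)))

/-- Register 7 gets the number of unassigned bakers in range of the location in register 6. -/
def countRange : Code :=
  .set 7 (.const 0) ;;
  .count 8 0 0 (.set 7 (.add (.reg 7) (.sub (feasBit 8 6) (.get 6 (.reg 8)))))

/-- Register 10 gets a location with a largest number of unassigned bakers in range. -/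
def pick : Code :=
  .set 9 (.const 0) ;;
  .count 6 2 0 (countRange ;;
    .ite (.get 7 (.reg 6)) .skip
      (.ite (.sub (.add (.reg 7) (.const 1)) (.reg 9))
        (.set 9 (.add (.reg 7) (.const 1)) ;; .set 10 (.reg 6)) .skip))

/-- The unassigned bakers in range of the location in register 10 are assigned to it. -/
def assign : Code :=
  .count 8 0 0 (.ite (.sub (feasBit 8 10) (.get 6 (.reg 8)))
    (.store 2 (.reg 8) (.reg 10) ;; .store 6 (.reg 8) (.const 1)) .skip)

/-- The greedy order (array 1) and the greedy assignment (array 2). -/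
def greedy : Code :=
  .count 5 2 0 (pick ;; .store 1 (.reg 5) (.reg 10) ;; .store 7 (.reg 10) (.const 1) ;; assign)

/-- The memory contains the game `G`; array 5 holds the positions where the rows begin. -/
structure Env {nb nm nl : ℕ} (G : Game (Fin nb) (Fin nm) (Fin nl)) (σ : Memory) : Prop where
  reg0 : σ.reg 0 = nb
  reg1 : σ.reg 1 = nm
  reg2 : σ.reg 2 = nl
  feas : ∀ (b : Fin nb) (l : Fin nl),
    σ.arr 0 (σ.arr 5 b + l) = if l ∈ G.feas b then 1 else 0

section Spec

variable {nb nm nl : ℕ} {G : Game (Fin nb) (Fin nm) (Fin nl)} {σ τ : Memory}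

theorem Env.congr (h : Env G σ) (hr : ∀ q < 3, τ.reg q = σ.reg q) (h0 : τ.arr 0 = σ.arr 0)
    (h5 : τ.arr 5 = σ.arr 5) : Env G τ :=
  ⟨by rw [hr 0 (by norm_num), h.reg0], by rw [hr 1 (by norm_num), h.reg1],
    by rw [hr 2 (by norm_num), h.reg2], by rw [h0, h5]; exact h.feas⟩

theorem Env.sem (h : Env G σ) {P : Code} (hP : P.wf = true) (h0 : 0 ∉ P.arrs) (h5 : 5 ∉ P.arrs) :
    Env G (P.sem σ) :=
  h.congr (fun _ hq => Code.sem_reg _ (Code.notMem_regs_of_wf hq hP)) (Code.sem_arr _ h0)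
    (Code.sem_arr _ h5)

theorem Env.frame (h : Env G σ) {P : Code} (hr : ∀ q, q ∉ P.regs → τ.reg q = σ.reg q) {as : List ℕ}
    (ha : ∀ a, a ∉ as → τ.arr a = σ.arr a) (hP : P.wf = true) (h0 : 0 ∉ as) (h5 : 5 ∉ as) :
    Env G τ :=
  h.congr (fun q hq => hr q (Code.notMem_regs_of_wf hq hP)) (ha 0 h0) (ha 5 h5)

theorem Env.val_feasBit (h : Env G σ) {rb rl : ℕ} {b : Fin nb} {l : Fin nl} (hb : σ.reg rb = b)
    (hl : σ.reg rl = l) : (feasBit rb rl).val σ = if l ∈ G.feas b then 1 else 0 := by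
  simp only [feasBit, Expr.val, hb, hl, h.feas]

theorem rowStarts_spec (hb : σ.reg 0 = nb) (hl : σ.reg 2 = nl) :
    ∀ j < nb, (rowStarts.sem σ).arr 5 j = j * nl := by
  refine (Code.sem_count (fun i τ => τ.reg 3 = i * nl ∧ ∀ j < i, τ.arr 5 j = j * nl)
    (by simpa [Code.sem] using hb) (by simp [Code.sem, Expr.val]) ?_).2
  rintro i τ hi hτi hr - ⟨h1, h2⟩
  have h2' : τ.reg 2 = nl := by rw [hr 2 (by decide)]; simpa [Code.sem] using hl
  refine ⟨?_, fun j hj => ?_⟩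
  · simp [Code.sem, Expr.val, h1, h2']; ring
  · simp only [Code.sem, Expr.val, Memory.setReg_arr, Memory.setArr_arr, hτi, h1, true_and]
    split
    · next h => rw [h]
    · exact h2 j (by omega)

theorem env_rowStarts (G : Game (Fin nb) (Fin nm) (Fin nl)) : Env G (rowStarts.sem G.encode) := by
  have hr : ∀ q < 3, (rowStarts.sem G.encode).reg q = G.encode.reg q := fun q hq =>
    Code.sem_reg _ (Code.notMem_regs_of_wf hq rfl)
  refine ⟨hr 0 (by norm_num), hr 1 (by norm_num), hr 2 (by norm_num), fun b l => ?_⟩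
  rw [rowStarts_spec rfl rfl b b.2, Code.sem_arr _ (by decide)]
  simp only [Game.encode, true_and]
  refine if_congr ⟨?_, fun h => ⟨b, l, rfl, h⟩⟩ rfl rfl
  rintro ⟨b', l', h, hf⟩
  -- Reduction modulo the row length recovers the column, so a matrix position determines baker and
  -- location.
  have hl : (l : ℕ) = l' := by
    have := congrArg (· % nl) h
    simpa [Nat.add_mod, Nat.mod_eq_of_lt] using this
  have hb : (b : ℕ) = b' := by
    rw [hl] at h
    exact Nat.eq_of_mul_eq_mul_right (Nat.zero_lt_of_lt l.2) (Nat.add_right_cancel h)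
  rw [Fin.ext hb, Fin.ext hl]
  exact hf

/-! #### The greedy phase -/

theorem countRange_spec (h : Env G σ) {U : Finset (Fin nb)}
    (hU : ∀ b : Fin nb, σ.arr 6 b = if b ∈ U then 0 else 1) {l : Fin nl} (hl : σ.reg 6 = l) :
    (countRange.sem σ).reg 7 = (U.filter fun b => l ∈ G.feas b).card := by
  -- The truncated difference of feasibility bit and assigned bit is 1 exactly for an unassigned
  -- baker in range.
  have key : (countRange.sem σ).reg 7 =
      ∑ j ∈ Finset.range nb, (σ.arr 0 (σ.arr 5 j + l) - σ.arr 6 j) := by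
    refine Code.sem_count (fun i τ => τ.reg 7 =
      ∑ j ∈ Finset.range i, (σ.arr 0 (σ.arr 5 j + l) - σ.arr 6 j))
      (by simpa [Code.sem] using h.reg0) (by simp [Code.sem, Expr.val]) ?_
    intro i τ hi hτi hr ha h1
    have h6 : τ.reg 6 = l := by rw [hr 6 (by decide)]; simpa [Code.sem] using hl
    simp only [Code.sem, feasBit, Expr.val, Memory.setReg_reg, h1, hτi, h6,
      ha 0 (by decide), ha 5 (by decide), ha 6 (by decide), Finset.sum_range_succ]
    simp
  rw [key, Finset.sum_range, ← Finset.filter_univ_mem U, Finset.filter_filter, Finset.card_filter]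
  refine Finset.sum_congr rfl fun b _ => ?_
  rw [h.feas, hU]
  by_cases h1 : b ∈ U <;> by_cases h2 : l ∈ G.feas b <;> simp [h1, h2]

/-- Register 9 holds the best count so far plus one. Thus 0 means that no candidate has been seen,
and an unselected location with nobody in range still qualifies. -/
theorem pick_spec (h : Env G σ) {U : Finset (Fin nb)}
    (hU : ∀ b : Fin nb, σ.arr 6 b = if b ∈ U then 0 else 1) {S : Finset (Fin nl)}
    (hS : ∀ l : Fin nl, σ.arr 7 l = if l ∈ S then 1 else 0) (hne : ∃ l, l ∉ S) :
    ∃ l₀ ∉ S, (pick.sem σ).reg 10 = (l₀ : ℕ) ∧ ∀ l ∉ S,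
      (U.filter fun b => l ∈ G.feas b).card ≤ (U.filter fun b => l₀ ∈ G.feas b).card := by
  have key : (∀ l : Fin nl, (l : ℕ) < nl → l ∉ S →
        (U.filter fun b => l ∈ G.feas b).card < (pick.sem σ).reg 9) ∧
      ((pick.sem σ).reg 9 = 0 ∨ ∃ l₀ ∉ S, (pick.sem σ).reg 10 = (l₀ : ℕ) ∧
        (pick.sem σ).reg 9 = (U.filter fun b => l₀ ∈ G.feas b).card + 1) := by
    refine Code.sem_count (fun i τ =>
      (∀ l : Fin nl, (l : ℕ) < i → l ∉ S → (U.filter fun b => l ∈ G.feas b).card < τ.reg 9) ∧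
      (τ.reg 9 = 0 ∨ ∃ l₀ ∉ S, τ.reg 10 = (l₀ : ℕ) ∧
        τ.reg 9 = (U.filter fun b => l₀ ∈ G.feas b).card + 1)) (by simpa [Code.sem] using h.reg2)
      ⟨by simp, Or.inl (by simp [Code.sem, Expr.val])⟩ ?_
    rintro i τ hi hτi hr ha ⟨h1, h2⟩
    have hτ : Env G τ := (h.sem (P := .set 9 (.const 0)) rfl (by decide) (by decide)).frame
      hr ha rfl (by decide) (by decide)
    have h7 := countRange_spec hτ (U := U) (by rw [ha 6 (by decide)]; exact hU)
      (l := ⟨i, hi⟩) hτi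
    have hf9 : (countRange.sem τ).reg 9 = τ.reg 9 := Code.sem_reg _ (by decide)
    have hf10 : (countRange.sem τ).reg 10 = τ.reg 10 := Code.sem_reg _ (by decide)
    have hf6 : (countRange.sem τ).reg 6 = i := by rw [Code.sem_reg _ (by decide), hτi]
    have hS' : (countRange.sem τ).arr 7 i = if ⟨i, hi⟩ ∈ S then 1 else 0 := by
      rw [Code.sem_arr _ (by decide), ha 7 (by decide)]; exact hS ⟨i, hi⟩
    have hlt : ∀ l : Fin nl, (l : ℕ) < i + 1 → (l : ℕ) < i ∨ l = ⟨i, hi⟩ := fun l hl => by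
      rcases Nat.lt_succ_iff_lt_or_eq.1 hl with h | h
      · exact Or.inl h
      · exact Or.inr (Fin.ext h)
    simp only [Code.sem, Expr.val, hf6, hS']
    by_cases hiS : (⟨i, hi⟩ : Fin nl) ∈ S
    · simp only [hiS, if_true]
      simp only [ne_eq, one_ne_zero, not_false_eq_true, if_true, Memory.setReg_reg, hf9, hf10]
      refine ⟨fun l hl hlS => ?_, by simpa using h2⟩
      rcases hlt l hl with hl | rfl
      · simpa using h1 l hl hlS
      · exact absurd hiS hlS
    · simp only [hiS, if_false, ne_eq, not_true_eq_false, hf9, h7]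
      split
      · next hc =>
        simp only [Memory.setReg_reg, hf6]
        refine ⟨fun l hl hlS => ?_, Or.inr ⟨⟨i, hi⟩, hiS, by simp, by simp⟩⟩
        rcases hlt l hl with hl | rfl
        · have := h1 l hl hlS
          simp only [show (9 : ℕ) ≠ 6 by decide, show (9 : ℕ) ≠ 10 by decide, if_false, if_true]
          omega
        · simp
      · next hc =>
        simp only [Memory.setReg_reg, hf9, hf10]
        refine ⟨fun l hl hlS => ?_, by simpa using h2⟩
        rcases hlt l hl with hl | rfl
        · simpa using h1 l hl hlS
        · simp only [show (9 : ℕ) ≠ 6 by decide, if_false]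
          omega
  obtain ⟨l, hl⟩ := hne
  obtain ⟨h1, h2⟩ := key
  rcases h2 with h2 | ⟨l₀, h3, h4, h5⟩
  · have := h1 l l.2 hl
    omega
  · refine ⟨l₀, h3, h4, fun l' hl' => ?_⟩
    have := h1 l' l'.2 hl'
    omega

theorem assign_spec (h : Env G σ) {U : Finset (Fin nb)}
    (hU : ∀ b : Fin nb, σ.arr 6 b = if b ∈ U then 0 else 1) {s : Fin nb → Fin nl}
    (hs : ∀ b : Fin nb, σ.arr 2 b = s b) {l : Fin nl} (hl : σ.reg 10 = l) :
    (∀ b : Fin nb, (assign.sem σ).arr 6 b = if b ∈ U.filter fun b => l ∉ G.feas b then 0 else 1) ∧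
    ∀ b : Fin nb, (assign.sem σ).arr 2 b =
      ((if b ∈ U ∧ l ∈ G.feas b then l else s b : Fin nl) : ℕ) := by
  suffices key : ∀ b : Fin nb,
      ((assign.sem σ).arr 6 b = if (b : ℕ) < nb then (if b ∈ U ∧ l ∉ G.feas b then 0 else 1)
        else if b ∈ U then 0 else 1) ∧
      ((assign.sem σ).arr 2 b = if (b : ℕ) < nb then
        ((if b ∈ U ∧ l ∈ G.feas b then l else s b : Fin nl) : ℕ) else s b) by
    constructor <;> intro b <;> have := key b <;> simp [this]
  refine Code.sem_count (fun i τ => ∀ b : Fin nb,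
      (τ.arr 6 b = if (b : ℕ) < i then (if b ∈ U ∧ l ∉ G.feas b then 0 else 1)
        else if b ∈ U then 0 else 1) ∧
      (τ.arr 2 b = if (b : ℕ) < i then ((if b ∈ U ∧ l ∈ G.feas b then l else s b : Fin nl) : ℕ)
        else s b)) (by simpa using h.reg0) (by simpa using fun b => ⟨hU b, hs b⟩) ?_
  intro i τ hi hτi hr ha h1
  have hτ : Env G τ := h.frame hr ha rfl (by decide) (by decide)
  have h10 : τ.reg 10 = l := by rw [hr 10 (by decide), hl]
  have hF := hτ.val_feasBit (rb := 8) (rl := 10) (b := ⟨i, hi⟩) hτi h10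
  have hi1 := h1 ⟨i, hi⟩
  simp only [lt_irrefl, if_false] at hi1
  simp only [Code.sem, Expr.val, hF, hτi, hi1.1]
  intro b
  have hb := h1 b
  by_cases hbi : (b : ℕ) = i
  · obtain rfl : b = ⟨i, hi⟩ := Fin.ext hbi
    by_cases h2 : (⟨i, hi⟩ : Fin nb) ∈ U <;> by_cases h3 : l ∈ G.feas ⟨i, hi⟩ <;>
      simp [h2, h3, h10, hi1, hτi]
  · have hiff : (b : ℕ) < i + 1 ↔ (b : ℕ) < i := by omega
    simp only [hiff]
    by_cases h2 : (⟨i, hi⟩ : Fin nb) ∈ U <;> by_cases h3 : l ∈ G.feas ⟨i, hi⟩ <;>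
      simp [h2, h3, hbi, hb, h10, hτi]

theorem exists_notMem_image {i : ℕ} (hi : i < nl) (w : ℕ → Fin nl) :
    ∃ l, l ∉ (Finset.range i).image w := by
  by_contra! hc
  have h1 : (Finset.univ : Finset (Fin nl)).card ≤ ((Finset.range i).image w).card :=
    Finset.card_le_card fun l _ => hc l
  have h2 := Finset.card_image_le (s := Finset.range i) (f := w)
  simp at h1 h2
  omega

/-- The bakers that are unassigned when the locations `w j`, `j < i`, have been selected. -/
def Game.remaining (G : Game (Fin nb) (Fin nm) (Fin nl)) (w : ℕ → Fin nl) (i : ℕ) :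
    Finset (Fin nb) :=
  Finset.univ.filter fun b => ∀ j < i, w j ∉ G.feas b

theorem Game.remaining_update (w : ℕ → Fin nl) (l : Fin nl) {i j : ℕ} (h : j ≤ i) :
    G.remaining (Function.update w i l) j = G.remaining w j := by
  refine Finset.filter_congr fun b _ => forall₂_congr fun k hk => ?_
  rw [Function.update_of_ne (by omega)]

theorem Game.remaining_update_succ (w : ℕ → Fin nl) (l : Fin nl) (i : ℕ) :
    G.remaining (Function.update w i l) (i + 1) =
      (G.remaining w i).filter fun b => l ∉ G.feas b := by
  rw [← Game.remaining_update w l le_rfl]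
  ext b
  simp only [Game.remaining, Finset.mem_filter, Finset.mem_univ, true_and, Nat.lt_succ_iff_lt_or_eq]
  constructor
  · exact fun h => ⟨fun j hj => h j (Or.inl hj), by simpa using h i (Or.inr rfl)⟩
  · rintro ⟨h1, h2⟩ j (hj | rfl)
    · exact h1 j hj
    · simpa using h2

theorem image_update_range (w : ℕ → Fin nl) (l : Fin nl) {i j : ℕ} (h : j ≤ i) :
    (Finset.range j).image (Function.update w i l) = (Finset.range j).image w := by
  refine Finset.image_congr fun k hk => ?_
  have : k < j := by simpa using hk
  rw [Function.update_of_ne (by omega)]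

/-- What holds after `i` rounds of the greedy phase. -/
structure GreedyInv (G : Game (Fin nb) (Fin nm) (Fin nl)) (i : ℕ) (σ : Memory) (w : ℕ → Fin nl)
    (s : Fin nb → Fin nl) : Prop where
  order : ∀ j < i, σ.arr 1 j = w j
  selected : ∀ l : Fin nl, σ.arr 7 l = if l ∈ (Finset.range i).image w then 1 else 0
  assigned : ∀ b : Fin nb, σ.arr 6 b = if b ∈ G.remaining w i then 0 else 1
  profile : ∀ b : Fin nb, σ.arr 2 b = s b
  new : ∀ j < i, w j ∉ (Finset.range j).image w
  greedy : ∀ j < i, ∀ l ∉ (Finset.range j).image w,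
    ((G.remaining w j).filter fun b => l ∈ G.feas b).card ≤
      ((G.remaining w j).filter fun b => w j ∈ G.feas b).card
  assignment : ∀ j < i, ∀ b ∈ G.remaining w j, w j ∈ G.feas b → s b = w j

/-- The order is carried as a total function `ℕ → Fin nl`, so a round is a `Function.update` at `i`,
which leaves everything about earlier rounds unchanged; values beyond the current round are
irrelevant. -/
theorem greedy_inv (h : Env G σ) (hnl : 0 < nl) (h2 : ∀ k, σ.arr 2 k = 0) (h6 : ∀ k, σ.arr 6 k = 0)
    (h7 : ∀ k, σ.arr 7 k = 0) : ∃ w s, GreedyInv G nl (greedy.sem σ) w s := by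
  refine Code.sem_count (fun i τ => ∃ w s, GreedyInv G i τ w s) (by simpa using h.reg2)
    ⟨fun _ => ⟨0, hnl⟩, fun _ => ⟨0, hnl⟩, by constructor <;> simp [h2, h6, h7, Game.remaining]⟩ ?_
  rintro i τ hi hτi hr ha ⟨w, s, I⟩
  have hτ : Env G τ := h.frame hr ha rfl (by decide) (by decide)
  obtain ⟨l, hlS, h10, hmax⟩ := pick_spec hτ I.assigned I.selected (exists_notMem_image hi w)
  set τ₁ := (pick ;; .store 1 (.reg 5) (.reg 10) ;; .store 7 (.reg 10) (.const 1)).sem τ with hτ₁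
  have hτ₁E : Env G τ₁ := hτ.sem rfl (by decide) (by decide)
  have hp : ∀ a, (pick.sem τ).arr a = τ.arr a := fun a =>
    Code.sem_arr _ (by simp [pick, countRange, Code.arrs])
  have hp5 : (pick.sem τ).reg 5 = i := by rw [Code.sem_reg _ (by decide), hτi]
  have ha6 : τ₁.arr 6 = τ.arr 6 := by rw [hτ₁, Code.sem_arr _ (by decide)]
  have ha2 : τ₁.arr 2 = τ.arr 2 := by rw [hτ₁, Code.sem_arr _ (by decide)]
  have hr10 : τ₁.reg 10 = l := by rw [hτ₁]; simpa [Code.sem] using h10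
  obtain ⟨h6', h2'⟩ := assign_spec hτ₁E (U := G.remaining w i) (by rw [ha6]; exact I.assigned)
    (s := s) (by rw [ha2]; exact I.profile) hr10
  have ha1 : (assign.sem τ₁).arr 1 = τ₁.arr 1 := Code.sem_arr _ (by decide)
  have ha7 : (assign.sem τ₁).arr 7 = τ₁.arr 7 := Code.sem_arr _ (by decide)
  refine ⟨Function.update w i l, fun b => if b ∈ G.remaining w i ∧ l ∈ G.feas b then l else s b, ?_⟩
  change GreedyInv G (i + 1) ((assign.sem τ₁).setReg 5 (i + 1)) _ _
  have hsucc : ∀ j < i + 1, j < i ∨ j = i := fun j hj => Nat.lt_succ_iff_lt_or_eq.1 hj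
  constructor
  · intro j hj
    rw [Memory.setReg_arr, ha1, hτ₁]
    simp only [Code.sem, Expr.val, Memory.setArr_arr, Memory.setArr_reg, hp5, hp, h10]
    rcases hsucc j hj with hj | rfl
    · simp [hj.ne, I.order j hj]
    · simp
  · intro l'
    rw [Memory.setReg_arr, ha7, hτ₁, Finset.range_add_one, Finset.image_insert,
      image_update_range w l le_rfl, Function.update_self]
    simp only [Code.sem, Expr.val, Memory.setArr_arr, Memory.setArr_reg, hp, h10, I.selected l',
      Finset.mem_insert, Fin.ext_iff (a := l')]
    by_cases hl' : (l' : ℕ) = l <;> simp [hl']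
  · rw [Game.remaining_update_succ]
    exact h6'
  · exact h2'
  · intro j hj
    rcases hsucc j hj with hj | rfl
    · rw [image_update_range _ _ hj.le, Function.update_of_ne hj.ne]
      exact I.new j hj
    · rw [image_update_range _ _ le_rfl, Function.update_self]
      exact hlS
  · intro j hj
    rcases hsucc j hj with hj | rfl
    · rw [image_update_range _ _ hj.le, Function.update_of_ne hj.ne, Game.remaining_update _ _ hj.le]
      exact I.greedy j hj
    · rw [image_update_range _ _ le_rfl, Function.update_self, Game.remaining_update _ _ le_rfl]
      exact hmax
  · intro j hj b
    rcases hsucc j hj with hj | rfl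
    · rw [Function.update_of_ne hj.ne, Game.remaining_update _ _ hj.le]
      intro hb hf
      rw [if_neg]
      · exact I.assignment j hj b hb hf
      · rintro ⟨hb', -⟩
        exact (Finset.mem_filter.1 hb').2 j hj hf
    · rw [Function.update_self, Game.remaining_update _ _ le_rfl]
      intro hb hf
      rw [if_pos ⟨hb, hf⟩]

theorem greedy_spec (h : Env G σ) (hnl : 0 < nl) (h2 : ∀ k, σ.arr 2 k = 0)
    (h6 : ∀ k, σ.arr 6 k = 0) (h7 : ∀ k, σ.arr 7 k = 0) :
    ∃ (ord : Fin nl ≃ Fin nl) (s : Fin nb → Fin nl), (greedy.sem σ).Holds 1 ord ∧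
      (greedy.sem σ).Holds 2 s ∧ G.IsGreedyOrder ord ∧ G.IsGreedyAssignment ord s := by
  obtain ⟨w, s, I⟩ := greedy_inv h hnl h2 h6 h7
  -- Each selected location is new, so the order is injective, hence bijective on a finite type.
  have hlt : ∀ i j : ℕ, i < j → j < nl → w i ≠ w j := fun i j hij hj he =>
    I.new j hj (Finset.mem_image.2 ⟨i, by simpa using hij, he⟩)
  have hinj : Function.Injective fun j : Fin nl => w j := by
    intro i j hij
    rcases lt_trichotomy i j with hlt' | heq | hlt'
    · exact absurd hij (hlt _ _ hlt' j.2)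
    · exact heq
    · exact absurd hij.symm (hlt _ _ hlt' i.2)
  have hun : ∀ i : Fin nl, G.unassigned
      (Equiv.ofBijective _ (Finite.injective_iff_bijective.1 hinj)) i = G.remaining w i := by
    intro i
    refine Finset.filter_congr fun b _ => ⟨fun hb j hj => ?_, fun hb j hj => hb j hj⟩
    exact hb ⟨j, hj.trans i.2⟩ hj
  refine ⟨Equiv.ofBijective _ (Finite.injective_iff_bijective.1 hinj), s,
    fun j => I.order j j.2, I.profile, fun i j hij => ?_, fun i b hb hf => ?_⟩
  · rw [Game.inRange, Game.inRange, hun]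
    refine I.greedy i i.2 _ fun hmem => ?_
    obtain ⟨k, hk, hk'⟩ := Finset.mem_image.1 hmem
    exact hlt k j ((Finset.mem_range.1 hk).trans_le hij) j.2 hk'
  · rw [hun] at hb
    exact I.assignment i i.2 b hb hf

end Spec

/-! ### Products, counts and the insertion of the millers -/

/-- Register 23 gets the product of registers 21 and 22. -/
def mul : Code :=
  .set 23 (.const 0) ;;
  .count 20 0 0 (.ite (.sub (.reg 21) (.reg 20)) (.set 23 (.add (.reg 23) (.reg 22))) .skip)

/-- The counts of the baker profile in array `a` are added to array `c`. -/
def addCounts (a c : ℕ) : Code :=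
  .count 24 0 0 (.store c (.get a (.reg 24)) (.add (.get c (.get a (.reg 24))) (.const 1)))

/-- Register 12 gets the first location, with respect to the order in array 1, that maximizes the
insertion value. -/
def bestInsertion : Code :=
  .set 12 (.get 1 (.const 0)) ;;
  .count 13 2 0 (
    .set 14 (.get 1 (.reg 13)) ;;
    .set 21 (.get 8 (.reg 14)) ;; .set 22 (.add (.get 9 (.reg 12)) (.const 1)) ;; mul ;;
    .set 15 (.reg 23) ;;
    .set 21 (.get 8 (.reg 12)) ;; .set 22 (.add (.get 9 (.reg 14)) (.const 1)) ;; mul ;;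
    .ite (.sub (.reg 15) (.reg 23)) (.set 12 (.reg 14)) .skip)

/-- The insertion of the millers (array 3). -/
def insertion : Code :=
  .count 11 1 0 (bestInsertion ;; .store 3 (.reg 11) (.reg 12) ;;
    .store 9 (.reg 12) (.add (.get 9 (.reg 12)) (.const 1)))

section Spec

variable {nb nm nl : ℕ} {G : Game (Fin nb) (Fin nm) (Fin nl)} {σ τ : Memory}

/-- Repeated addition over `nb` rounds, so the first factor must be at most `nb`; in every use it is
a number of bakers. -/
theorem mul_spec (h : Env G σ) {x y : ℕ} (hx : σ.reg 21 = x) (hxb : x ≤ nb) (hy : σ.reg 22 = y) :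
    (mul.sem σ).reg 23 = x * y := by
  rw [← min_eq_right hxb]
  refine Code.sem_count (fun i τ => τ.reg 23 = min i x * y)
    (by simpa [Code.sem] using h.reg0) (by simp [Code.sem, Expr.val]) ?_
  intro i τ hi hτi hr ha h1
  have h21 : τ.reg 21 = x := by rw [hr 21 (by decide)]; simpa [Code.sem] using hx
  have h22 : τ.reg 22 = y := by rw [hr 22 (by decide)]; simpa [Code.sem] using hy
  simp only [Code.sem, Expr.val, h21, hτi, h22, h1]
  split
  · rw [min_eq_left (by omega : i ≤ x), min_eq_left (by omega : i + 1 ≤ x)]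
    simp; ring
  · rw [min_eq_right (by omega : x ≤ i + 1)]
    simp [h1, min_eq_right (by omega : x ≤ i)]

theorem addCounts_spec (h : Env G σ) {a c : ℕ} (hac : a ≠ c) {x : Fin nb → Fin nl}
    (hx : ∀ b : Fin nb, σ.arr a b = x b) (hc : ∀ k, σ.arr c k = 0) (l : Fin nl) :
    ((addCounts a c).sem σ).arr c l = count x l := by
  have key : ((addCounts a c).sem σ).arr c l =
      ∑ j ∈ Finset.range nb, if σ.arr a j = l then 1 else 0 := by
    refine Code.sem_count (fun i τ => τ.arr c l =
      ∑ j ∈ Finset.range i, if σ.arr a j = l then 1 else 0)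
      (by simpa using h.reg0) (by simp [hc]) ?_
    intro i τ hi hτi hr ha h1
    rw [Finset.sum_range_succ, ← h1]
    simp only [Code.sem, Expr.val, hτi, Memory.setReg_arr, Memory.setArr_arr,
      ha a (by simpa [Code.arrs] using hac), true_and]
    by_cases hl : σ.arr a i = l
    · simp [hl]
    · simp [hl, Ne.symm hl]
  rw [key, Finset.sum_range, count, Finset.card_filter]
  exact Finset.sum_congr rfl fun b _ => by simp [hx, Fin.ext_iff]

/-- The value of a location with `k` millers for a further miller. -/
def slotValue (s : Fin nb → Fin nl) (A : Fin nl → ℕ) (l : Fin nl) : ℚ :=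
  (count s l : ℚ) / ((A l : ℚ) + 1)

/-- Values are compared by cross-multiplication, and the candidate is replaced only on strict
improvement, so the first maximizer along the order survives. -/
theorem bestInsertion_spec (h : Env G σ) (hnl : 0 < nl) {ord : Fin nl → Fin nl}
    {s : Fin nb → Fin nl} {A : Fin nl → ℕ} (ho : σ.Holds 1 ord)
    (hs : ∀ l : Fin nl, σ.arr 8 l = count s l) (hA : ∀ l : Fin nl, σ.arr 9 l = A l) :
    ∃ m : Fin nl, (bestInsertion.sem σ).reg 12 = ord m ∧
      (∀ j, slotValue s A (ord j) ≤ slotValue s A (ord m)) ∧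
      ∀ j < m, slotValue s A (ord j) < slotValue s A (ord m) := by
  suffices key : ∃ m : Fin nl, (bestInsertion.sem σ).reg 12 = ord m ∧
      (∀ j : Fin nl, (j : ℕ) < nl → slotValue s A (ord j) ≤ slotValue s A (ord m)) ∧
      ((m : ℕ) < nl ∨ (m : ℕ) = 0) ∧
      ∀ j < m, slotValue s A (ord j) < slotValue s A (ord m) by
    obtain ⟨m, h1, h2, -, h3⟩ := key
    exact ⟨m, h1, fun j => h2 j j.2, h3⟩
  refine Code.sem_count (fun i τ => ∃ m : Fin nl, τ.reg 12 = ord m ∧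
      (∀ j : Fin nl, (j : ℕ) < i → slotValue s A (ord j) ≤ slotValue s A (ord m)) ∧
      ((m : ℕ) < i ∨ (m : ℕ) = 0) ∧
      ∀ j < m, slotValue s A (ord j) < slotValue s A (ord m))
    (by simpa [Code.sem] using h.reg2)
    ⟨⟨0, hnl⟩, by simpa [Code.sem, Expr.val] using ho ⟨0, hnl⟩, by simp, Or.inr rfl,
      fun j hj => absurd hj (by simp [Fin.lt_def])⟩ ?_
  rintro i τ hi hτi hr ha ⟨m, hm, hmax, hmi, hstrict⟩
  have hτ : Env G τ := (h.sem (P := .set 12 (.get 1 (.const 0))) rfl (by decide) (by decide)).frame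
    hr ha rfl (by decide) (by decide)
  have hr12 : τ.reg 12 = ord m := hm
  have ho' : τ.arr 1 i = ord ⟨i, hi⟩ := by rw [ha 1 (by decide)]; exact ho ⟨i, hi⟩
  have hs' : ∀ l : Fin nl, τ.arr 8 l = count s l := by rw [ha 8 (by decide)]; exact hs
  have hA' : ∀ l : Fin nl, τ.arr 9 l = A l := by rw [ha 9 (by decide)]; exact hA
  set τ₁ := (.set 14 (.get 1 (.reg 13)) ;; .set 21 (.get 8 (.reg 14)) ;;
    .set 22 (.add (.get 9 (.reg 12)) (.const 1)) : Code).sem τ with hτ₁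
  have hE₁ : Env G τ₁ := hτ.sem rfl (by decide) (by decide)
  have hm₁ := mul_spec hE₁ (x := count s (ord ⟨i, hi⟩)) (y := A (ord m) + 1)
    (by simp [hτ₁, Code.sem, Expr.val, hτi, ho', hs'])
    ((count_le_card _ _).trans (by simp))
    (by simp [hτ₁, Code.sem, Expr.val, hr12, hA'])
  have h12 : (mul.sem τ₁).reg 12 = ord m := by
    rw [Code.sem_reg _ (by decide), hτ₁, Code.sem_reg _ (by decide), hr12]
  have h14 : (mul.sem τ₁).reg 14 = ord ⟨i, hi⟩ := by
    rw [Code.sem_reg _ (by decide)]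
    simp [hτ₁, Code.sem, Expr.val, hτi, ho']
  set τ₂ := (mul ;; .set 15 (.reg 23) ;; .set 21 (.get 8 (.reg 12)) ;;
    .set 22 (.add (.get 9 (.reg 14)) (.const 1)) : Code).sem τ₁ with hτ₂
  have hE₂ : Env G τ₂ := hE₁.sem rfl (by decide) (by decide)
  have ha₁ : ∀ a, (mul.sem τ₁).arr a = τ.arr a := fun a => by
    rw [Code.sem_arr _ (by simp [mul, Code.arrs])]; rfl
  have hm₂ := mul_spec hE₂ (x := count s (ord m)) (y := A (ord ⟨i, hi⟩) + 1)
    (by simp [hτ₂, Code.sem, Expr.val, h12, ha₁, hs'])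
    ((count_le_card _ _).trans (by simp))
    (by simp [hτ₂, Code.sem, Expr.val, h14, ha₁, hA'])
  have h15 : (mul.sem τ₂).reg 15 = count s (ord ⟨i, hi⟩) * (A (ord m) + 1) := by
    rw [Code.sem_reg _ (by decide), ← hm₁]
    simp [hτ₂, Code.sem, Expr.val]
  have h12' : (mul.sem τ₂).reg 12 = ord m := by
    rw [Code.sem_reg _ (by decide), ← h12]
    simp [hτ₂, Code.sem]
  have h14' : (mul.sem τ₂).reg 14 = ord ⟨i, hi⟩ := by
    rw [Code.sem_reg _ (by decide), ← h14]
    simp [hτ₂, Code.sem]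
  have hlt : slotValue s A (ord m) < slotValue s A (ord ⟨i, hi⟩) ↔
      count s (ord m) * (A (ord ⟨i, hi⟩) + 1) < count s (ord ⟨i, hi⟩) * (A (ord m) + 1) := by
    rw [slotValue, slotValue, div_lt_div_iff₀ (by positivity) (by positivity)]
    exact_mod_cast Iff.rfl
  have hj : ∀ j : Fin nl, (j : ℕ) < i + 1 → (j : ℕ) < i ∨ j = ⟨i, hi⟩ := fun j hj => by
    rcases Nat.lt_succ_iff_lt_or_eq.1 hj with h | h
    · exact Or.inl h
    · exact Or.inr (Fin.ext h)
  change ∃ m : Fin nl, (((Code.ite (.sub (.reg 15) (.reg 23)) (.set 12 (.reg 14)) .skip).sem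
    (mul.sem τ₂)).setReg 13 (i + 1)).reg 12 = ord m ∧ _
  simp only [Code.sem, Expr.val, h15, hm₂, Nat.sub_ne_zero_iff_lt, ← hlt]
  split
  · next hc =>
    refine ⟨⟨i, hi⟩, by simp [h14'], fun j hji => ?_, Or.inl (Nat.lt_succ_self i), fun j hji => ?_⟩
    · rcases hj j hji with hji | rfl
      · exact (hmax j hji).trans hc.le
      · exact le_rfl
    · exact (hmax j hji).trans_lt hc
  · next hc =>
    refine ⟨m, by simp [h12'], fun j hji => ?_, by omega, hstrict⟩
    rcases hj j hji with hji | rfl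
    · exact hmax j hji
    · exact not_lt.1 hc

/-- The number of millers at `l` among the first `k`. -/
def firstCount (t : ℕ → Fin nl) (k : ℕ) (l : Fin nl) : ℕ :=
  ∑ j ∈ Finset.range k, if t j = l then 1 else 0

theorem firstCount_update (t : ℕ → Fin nl) (m l : Fin nl) {k i : ℕ} (h : k ≤ i) :
    firstCount (Function.update t i m) k l = firstCount t k l := by
  refine Finset.sum_congr rfl fun j hj => ?_
  have := Finset.mem_range.1 hj
  rw [Function.update_of_ne (by omega)]

theorem insertion_spec (h : Env G σ) (hnl : 0 < nl) {ord : Fin nl ≃ Fin nl}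
    {s : Fin nb → Fin nl} (ho : σ.Holds 1 ord) (hs : ∀ l : Fin nl, σ.arr 8 l = count s l)
    (h9 : ∀ k, σ.arr 9 k = 0) :
    ∃ t : Fin nm → Fin nl, (insertion.sem σ).Holds 3 t ∧
      (∀ l : Fin nl, (insertion.sem σ).arr 9 l = count t l) ∧
      Game.IsInsertion ord s (Equiv.refl (Fin nm)) t := by
  have key : ∃ t : ℕ → Fin nl, (∀ j < nm, (insertion.sem σ).arr 3 j = t j) ∧
      (∀ l : Fin nl, (insertion.sem σ).arr 9 l = firstCount t nm l) ∧
      ∀ k < nm, ∃ m, t k = ord m ∧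
        (∀ j, slotValue s (firstCount t k) (ord j) ≤ slotValue s (firstCount t k) (ord m)) ∧
        ∀ j < m, slotValue s (firstCount t k) (ord j) < slotValue s (firstCount t k) (ord m) := by
    refine Code.sem_count (fun i τ => ∃ t : ℕ → Fin nl, (∀ j < i, τ.arr 3 j = t j) ∧
      (∀ l : Fin nl, τ.arr 9 l = firstCount t i l) ∧
      ∀ k < i, ∃ m, t k = ord m ∧
        (∀ j, slotValue s (firstCount t k) (ord j) ≤ slotValue s (firstCount t k) (ord m)) ∧
        ∀ j < m, slotValue s (firstCount t k) (ord j) < slotValue s (firstCount t k) (ord m))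
      (by simpa using h.reg1) ⟨fun _ => ⟨0, hnl⟩, by simp, by simp [h9, firstCount], by simp⟩ ?_
    rintro i τ hi hτi hr ha ⟨t, h3, h9, hins⟩
    have hτ : Env G τ := h.frame hr ha rfl (by decide) (by decide)
    obtain ⟨m, hm, hmax, hstrict⟩ := bestInsertion_spec hτ hnl (ord := ord) (s := s)
      (A := firstCount t i)
      (by simpa only [Memory.Holds, ha 1 (by decide : 1 ∉ [3, 9])] using ho)
      (by rw [ha 8 (by decide)]; exact hs) h9
    have hp : ∀ a, (bestInsertion.sem τ).arr a = τ.arr a := fun a =>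
      Code.sem_arr _ (by simp [bestInsertion, mul, Code.arrs])
    have hp11 : (bestInsertion.sem τ).reg 11 = i := by rw [Code.sem_reg _ (by decide), hτi]
    have hcongr : ∀ k ≤ i, firstCount (Function.update t i (ord m)) k = firstCount t k :=
      fun k hk => funext fun l => firstCount_update t (ord m) l hk
    simp only [Code.sem, Expr.val, Memory.setReg_arr, Memory.setArr_arr, Memory.setArr_reg, hp,
      hp11, hm]
    refine ⟨Function.update t i (ord m), fun j hj => ?_, fun l => ?_, fun k hk => ?_⟩
    · rcases Nat.lt_succ_iff_lt_or_eq.1 hj with hj | rfl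
      · simp [hj.ne, h3 j hj]
      · simp
    · rw [firstCount, Finset.sum_range_succ, ← firstCount, hcongr i le_rfl, Function.update_self]
      by_cases hl : l = ord m
      · simp [hl, h9]
      · simp [Fin.val_inj, hl, h9, Ne.symm hl]
    · rcases Nat.lt_succ_iff_lt_or_eq.1 hk with hk | rfl
      · rw [hcongr k hk.le, Function.update_of_ne hk.ne]
        exact hins k hk
      · rw [hcongr k le_rfl, Function.update_self]
        exact ⟨m, rfl, hmax, hstrict⟩
  obtain ⟨t, h1, h2, h3⟩ := key
  -- The running sum over natural numbers counts the same millers as the filter over `Fin nm`.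
  have hplaced : ∀ (k : Fin nm) l,
      Game.placed (Equiv.refl _) (fun j : Fin nm => t j) k l = firstCount t k l := by
    intro k l
    rw [Game.placed, firstCount, ← Finset.card_filter]
    symm
    refine Finset.card_bij' (fun j hj => ⟨j, ?_⟩) (fun j _ => j) ?_ ?_ ?_ ?_
    · simp only [Finset.mem_filter, Finset.mem_range] at hj
      exact hj.1.trans k.2
    · intro j hj
      simp only [Finset.mem_filter, Finset.mem_range, Finset.mem_univ, true_and] at hj ⊢
      exact hj
    · intro j hj
      simp only [Finset.mem_filter, Finset.mem_range, Finset.mem_univ, true_and] at hj ⊢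
      exact hj
    · exact fun _ _ => rfl
    · exact fun _ _ => rfl
  refine ⟨fun j => t j, fun j => h1 j j.2, fun l => ?_, fun k => ?_⟩
  · rw [h2, firstCount, Finset.sum_range, count, Finset.card_filter]
  · have hv : ∀ l, Game.insertionValue s (Equiv.refl _) (fun j : Fin nm => t j) k l =
        slotValue s (firstCount t k) l := fun l => by
      rw [Game.insertionValue, hplaced, slotValue]
    simp only [hv]
    exact h3 k k.2

end Spec

/-! ### Path search and improvement of the potential -/

/-- If the location in register 34 has been reached and is feasible for the baker in register 33,
then the location of this baker is reached. -/
def visit : Code :=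
  .ite (.get 11 (.reg 34)) (.ite (feasBit 33 34) (.ite (.get 11 (.get 4 (.reg 33))) .skip
    (.set 31 (.add (.reg 31) (.const 1)) ;; .store 11 (.get 4 (.reg 33)) (.reg 31) ;;
      .store 12 (.get 4 (.reg 33)) (.reg 33) ;; .store 13 (.get 4 (.reg 33)) (.reg 34)))
    .skip) .skip

/-- Visit all pairs of a baker and a location. -/
def scan : Code := .count 33 0 0 (.count 34 2 0 visit)

/-- Backward search from the location in register 30 along the edges of the profile in array 4.
Array 11 gets the positions of the reached locations in the order of discovery, array 12 the bakers
to be moved and array 13 their destinations. -/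
def search : Code :=
  .count 32 2 0 (.store 11 (.reg 32) (.const 0)) ;;
  .store 11 (.reg 30) (.const 1) ;; .set 31 (.const 1) ;; .count 32 2 0 scan

/-- Move the bakers on the path from the location in register 35 that has been found. -/
def follow : Code :=
  .set 37 (.reg 35) ;;
  .count 38 2 0 (.ite (.sub (.get 11 (.reg 37)) (.const 1))
    (.set 39 (.get 12 (.reg 37)) ;; .set 37 (.get 13 (.reg 37)) ;; .store 4 (.reg 39) (.reg 37))
    .skip)

/-- Move the bakers on the path that has been found and update their counts in array 10. -/
def augment : Code :=
  follow ;; .store 10 (.reg 35) (.sub (.get 10 (.reg 35)) (.const 1)) ;;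
  .store 10 (.reg 30) (.add (.get 10 (.reg 30)) (.const 1))

/-- Shift a baker from the location in register 35 to the one in register 30, if this is possible and
improves the potential. -/
def attempt : Code :=
  search ;; .set 21 (.get 10 (.reg 35)) ;; .set 22 (.get 9 (.reg 30)) ;; mul ;;
  .set 36 (.reg 23) ;; .set 21 (.get 10 (.reg 30)) ;; .set 22 (.get 9 (.reg 35)) ;; mul ;;
  .ite (.get 11 (.reg 35))
    (.ite (.sub (.reg 36) (.add (.reg 23) (.get 9 (.reg 35)))) augment .skip) .skip

/-- Attempt all pairs of locations. -/
def sweep : Code := .count 30 2 0 (.count 35 2 0 attempt)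

/-- Sufficiently many sweeps to reach a maximum of the potential. -/
def improve : Code := .count 40 1 1 (.count 41 0 0 (.count 42 0 0 (.count 43 0 0 sweep)))

section Spec

variable {nb nm nl : ℕ} {G : Game (Fin nb) (Fin nm) (Fin nl)} {x : Fin nb → Fin nl} {c : Fin nl}
  {σ τ : Memory}

/-- Invariant of the backward search from `c`. -/
structure Tree (G : Game (Fin nb) (Fin nm) (Fin nl)) (x : Fin nb → Fin nl) (c : Fin nl)
    (σ : Memory) : Prop where
  root : σ.arr 11 c = 1
  le : ∀ l : Fin nl, σ.arr 11 l ≤ σ.reg 31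
  card : σ.reg 31 = (Finset.univ.filter fun l : Fin nl => σ.arr 11 l ≠ 0).card
  next : ∀ a : Fin nl, a ≠ c → σ.arr 11 a ≠ 0 → 1 < σ.arr 11 a ∧ ∃ (b : Fin nb) (l : Fin nl),
    σ.arr 12 a = b ∧ σ.arr 13 a = l ∧ x b = a ∧ l ∈ G.feas b ∧
      σ.arr 11 l ≠ 0 ∧ σ.arr 11 l < σ.arr 11 a

theorem Tree.setReg (h : Tree G x c σ) {r : ℕ} (hr : 31 ≠ r) (v : ℕ) :
    Tree G x c (σ.setReg r v) :=
  ⟨h.root, by simpa [hr] using h.le, by rw [Memory.setReg_reg, if_neg hr]; exact h.card, h.next⟩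

theorem Tree.le_card (h : Tree G x c σ) : σ.reg 31 ≤ nl := by
  rw [h.card]
  exact (Finset.card_le_univ _).trans (by simp)

theorem Tree.reach (h : Tree G x c σ) {a : Fin nl} (ha : σ.arr 11 a ≠ 0) :
    Relation.ReflTransGen (G.Edge x) a c := by
  induction hn : σ.arr 11 a using Nat.strong_induction_on generalizing a with
  | _ n ih =>
    by_cases hac : a = c
    · rw [hac]
    obtain ⟨-, b, l, -, -, hb, hl, hl0, hlt⟩ := h.next a hac ha
    exact .head ⟨b, hb, hl⟩ (ih _ (hn ▸ hlt) hl0 rfl)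

/-- The pair `b`, `l` leads to no new location. -/
def Visited (G : Game (Fin nb) (Fin nm) (Fin nl)) (x : Fin nb → Fin nl) (σ : Memory) (b : Fin nb)
    (l : Fin nl) : Prop :=
  σ.arr 11 l ≠ 0 → l ∈ G.feas b → σ.arr 11 (x b) ≠ 0

/-- Once no pair leads to a new location, the reached set is closed under predecessors along edges,
so it contains every location with a path to the root. -/
theorem Tree.of_reach (h : Tree G x c σ) (hc : ∀ b l, Visited G x σ b l) {a : Fin nl}
    (ha : Relation.ReflTransGen (G.Edge x) a c) : σ.arr 11 a ≠ 0 := by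
  induction ha using Relation.ReflTransGen.head_induction_on with
  | refl => rw [h.root]; exact one_ne_zero
  | head hab _ ih =>
    obtain ⟨b, rfl, hb⟩ := hab
    exact hc b _ ih hb

/-- The state `τ` of the search has developed from `σ`; if no location has been reached in between,
then `Q` holds. -/
def Scanned (G : Game (Fin nb) (Fin nm) (Fin nl)) (x : Fin nb → Fin nl) (c : Fin nl)
    (σ τ : Memory) (Q : Prop) : Prop :=
  Tree G x c τ ∧ ((¬ (∀ b l, Visited G x σ b l) ∧ σ.reg 31 < τ.reg 31) ∨
    ((τ.arr 11 = σ.arr 11 ∧ τ.reg 31 = σ.reg 31) ∧ Q))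

theorem Scanned.setReg {Q : Prop} (h : Scanned G x c σ τ Q) {r : ℕ} (hr : 31 ≠ r) (v : ℕ) :
    Scanned G x c σ (τ.setReg r v) Q :=
  ⟨h.1.setReg hr v, by simpa [hr] using h.2⟩

theorem Scanned.mono {Q R : Prop} (h : Scanned G x c σ τ Q) (hQR : Q → R) :
    Scanned G x c σ τ R :=
  ⟨h.1, h.2.imp_right fun h => ⟨h.1, hQR h.2⟩⟩

/-- Only the last of the four cases discovers a location. It receives the largest number so far, so
its successor has a smaller one. A discovery also shows that the initial state was not closed:
otherwise nothing had changed before and this pair could not lead to a new location. -/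
theorem Scanned.visit {Q : Prop} (h : Scanned G x c σ τ Q) (hE : Env G τ)
    (hx : ∀ b : Fin nb, τ.arr 4 b = x b) {b : Fin nb} {l : Fin nl} (hb : τ.reg 33 = b)
    (hl : τ.reg 34 = l) : Scanned G x c σ (visit.sem τ) (Q ∧ Visited G x σ b l) := by
  obtain ⟨hT, hQ⟩ := h
  have hF := hE.val_feasBit hb hl
  simp only [BakersMillers.visit, Code.sem, Expr.val, hF, hb, hl, hx]
  by_cases hl0 : τ.arr 11 l = 0
  · simp only [hl0, ne_eq, not_true_eq_false, if_false]
    exact ⟨hT, hQ.imp_right fun h => ⟨h.1, h.2, fun h' => absurd (by rw [← h.1.1]; exact hl0) h'⟩⟩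
  by_cases hlf : l ∈ G.feas b
  swap
  · simp only [hl0, hlf, ne_eq, not_true_eq_false, not_false_eq_true, if_false, if_true]
    exact ⟨hT, hQ.imp_right fun h => ⟨h.1, h.2, fun _ h' => absurd h' hlf⟩⟩
  by_cases hb0 : τ.arr 11 (x b) = 0
  swap
  · simp only [hl0, hlf, hb0, ne_eq, one_ne_zero, not_false_eq_true, if_true]
    exact ⟨hT, hQ.imp_right fun h => ⟨h.1, h.2, fun _ _ => by rw [← h.1.1]; exact hb0⟩⟩
  simp only [hl0, hlf, hb0, ne_eq, one_ne_zero, not_false_eq_true, not_true_eq_false, if_true,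
    if_false, Memory.setReg_arr, Memory.setArr_arr, hx, Memory.setReg_reg, Memory.setArr_reg, hb, hl,
    show (4 : ℕ) ≠ 11 by decide, show (4 : ℕ) ≠ 12 by decide, show (33 : ℕ) ≠ 31 by decide,
    show (34 : ℕ) ≠ 31 by decide, false_and]
  have hxc : x b ≠ c := fun h => by rw [h, hT.root] at hb0; exact one_ne_zero hb0
  have hroot := hT.root
  have hpos : 0 < τ.reg 31 := by have := hT.le c; omega
  refine ⟨⟨?_, fun l' => ?_, ?_, fun a hac ha => ?_⟩, Or.inl ⟨fun hcl => ?_, ?_⟩⟩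
  · simp [Fin.val_inj, hxc.symm, hroot]
  · by_cases h : l' = x b
    · simp [h]
    · have := hT.le l'
      simp [Fin.val_inj, h]
      omega
  · have : (Finset.univ.filter fun l' : Fin nl =>
        (if l' = x b then τ.reg 31 + 1 else τ.arr 11 l') ≠ 0) =
        insert (x b) (Finset.univ.filter fun l : Fin nl => τ.arr 11 l ≠ 0) := by
      ext l'
      by_cases h : l' = x b <;> simp [h]
    simp only [Memory.setArr_arr, Memory.setArr_reg, Memory.setReg_reg, Memory.setReg_arr,
      Fin.val_inj]
    simp only [show (11 : ℕ) ≠ 13 by decide, show (11 : ℕ) ≠ 12 by decide, false_and, true_and,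
      if_false, if_true]
    rw [this, Finset.card_insert_of_notMem (by simp [hb0]), ← hT.card]
  · have hne : l ≠ x b := fun h => hl0 (h ▸ hb0)
    by_cases h : a = x b
    · subst h
      have := hT.le l
      refine ⟨by simp; omega, b, l, ?_⟩
      simp [Fin.val_inj, hne, hlf, hl0]
      omega
    · simp [Fin.val_inj, h] at ha ⊢
      obtain ⟨h1, b', l', h2, h3, h4, h5, h6, h7⟩ := hT.next a hac ha
      have hne' : l' ≠ x b := fun h => h6 (h ▸ hb0)
      exact ⟨h1, b', h2, l', h3, h4, h5, by simp [hne', h6, h7]⟩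
  · rcases hQ with h | h
    · exact h.1 hcl
    · have := hcl b l
      rw [Visited, ← h.1.1] at this
      exact this hl0 hlf hb0
  · rcases hQ with h | h
    · simp
      omega
    · simp [h.1.2]

theorem scan_spec (hE : Env G σ) (hx : ∀ b : Fin nb, σ.arr 4 b = x b) (hT : Tree G x c σ) :
    Scanned G x c σ (scan.sem σ) (∀ b l, Visited G x σ b l) := by
  suffices key : Scanned G x c σ (scan.sem σ)
      (∀ b : Fin nb, (b : ℕ) < nb → ∀ l, Visited G x σ b l) from
    key.mono fun h b => h b b.2
  refine Code.sem_count (fun i τ => Scanned G x c σ τ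
    (∀ b : Fin nb, (b : ℕ) < i → ∀ l, Visited G x σ b l)) (by simpa using hE.reg0)
    ⟨hT.setReg (by decide) 0, Or.inr ⟨by simp, by simp⟩⟩ ?_
  intro i τ hi hτi hr ha h1
  have hEτ : Env G τ := hE.frame hr ha rfl (by decide) (by decide)
  have hxτ : ∀ b : Fin nb, τ.arr 4 b = x b := by rw [ha 4 (by decide)]; exact hx
  have h2 : Scanned G x c σ ((Code.count 34 2 0 visit).sem τ)
      ((∀ b : Fin nb, (b : ℕ) < i → ∀ l, Visited G x σ b l) ∧
        ∀ l : Fin nl, (l : ℕ) < nl → Visited G x σ ⟨i, hi⟩ l) := by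
    refine Code.sem_count (fun j ρ => Scanned G x c σ ρ
      ((∀ b : Fin nb, (b : ℕ) < i → ∀ l, Visited G x σ b l) ∧
        ∀ l : Fin nl, (l : ℕ) < j → Visited G x σ ⟨i, hi⟩ l)) (by simpa using hEτ.reg2)
      ((h1.mono fun h => ⟨h, by simp⟩).setReg (by decide) 0) ?_
    intro j ρ hj hρj hr' ha' h3
    have hEρ : Env G ρ := hEτ.frame hr' ha' rfl (by decide) (by decide)
    have h4 := h3.visit hEρ (by rw [ha' 4 (by decide)]; exact hxτ) (b := ⟨i, hi⟩) (l := ⟨j, hj⟩)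
      (by rw [hr' 33 (by decide), hτi]) hρj
    refine (h4.mono fun h => ⟨h.1.1, fun l hl => ?_⟩).setReg (by decide) _
    rcases Nat.lt_succ_iff_lt_or_eq.1 hl with hl | hl
    · exact h.1.2 l hl
    · obtain rfl : l = ⟨j, hj⟩ := Fin.ext hl
      exact h.2
  refine (h2.mono fun h b hb l => ?_).setReg (by decide) _
  rcases Nat.lt_succ_iff_lt_or_eq.1 hb with hb | hb
  · exact h.1 b hb l
  · obtain rfl : b = ⟨i, hi⟩ := Fin.ext hb
    exact h.2 l l.2

theorem search_spec (hE : Env G σ) (hx : ∀ b : Fin nb, σ.arr 4 b = x b) (hc : σ.reg 30 = c) :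
    Tree G x c (search.sem σ) ∧ ∀ b l, Visited G x (search.sem σ) b l := by
  set τ := (Code.count 32 2 0 (.store 11 (.reg 32) (.const 0)) ;;
    .store 11 (.reg 30) (.const 1) ;; .set 31 (.const 1)).sem σ with hτ
  have hclear : ∀ l < nl, ((Code.count 32 2 0 (.store 11 (.reg 32) (.const 0))).sem σ).arr 11 l = 0 := by
    refine Code.sem_count (fun i τ => ∀ l < i, τ.arr 11 l = 0) (by simpa using hE.reg2) (by simp) ?_
    intro i τ hi hτi _ _ h l hl
    by_cases hli : l = i
    · simp [Code.sem, Expr.val, hτi, hli]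
    · simp [Code.sem, Expr.val, hτi, hli, h l (by omega)]
  have h30 : ((Code.count 32 2 0 (.store 11 (.reg 32) (.const 0))).sem σ).reg 30 = c := by
    rw [Code.sem_reg _ (by decide), hc]
  have h11 : ∀ l : Fin nl, τ.arr 11 l = if l = c then 1 else 0 := by
    intro l
    rw [hτ, Code.sem, Code.sem, Code.sem, Code.sem]
    simp only [Expr.val, h30, Memory.setReg_arr, Memory.setArr_arr, hclear l l.2, Fin.val_inj,
      true_and]
  have h31 : τ.reg 31 = 1 := by
    rw [hτ, Code.sem, Code.sem, Code.sem, Code.sem]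
    simp [Expr.val]
  have hEτ : Env G τ := hE.sem rfl (by decide) (by decide)
  have hxτ : ∀ b : Fin nb, τ.arr 4 b = x b := by rw [hτ, Code.sem_arr _ (by decide)]; exact hx
  have hT : Tree G x c τ := by
    refine ⟨by simp [h11], fun l => ?_, ?_, fun a hac ha => ?_⟩
    · rw [h11, h31]
      split <;> simp
    · rw [h31]
      simp [h11, Finset.filter_eq']
    · simp [h11, hac] at ha
  -- Every scan of a state that is not closed reaches a new location, and a closed state stays
  -- closed. After `nl` scans a state that is not closed would have reached more than `nl`
  -- locations.
  have key : Tree G x c (search.sem σ) ∧ (nl < (search.sem σ).reg 31 ∨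
      ∀ b l, Visited G x (search.sem σ) b l) := by
    refine Code.sem_count (σ := τ) (fun i ρ => Tree G x c ρ ∧ (i < ρ.reg 31 ∨
      ∀ b l, Visited G x ρ b l)) (by simpa using hEτ.reg2)
      ⟨hT.setReg (by decide) 0, Or.inl (by simp [h31])⟩ ?_
    rintro i ρ hi hρi hr ha ⟨h1, h2⟩
    have hEρ : Env G ρ := hEτ.frame hr ha rfl (by decide) (by decide)
    obtain ⟨h3, h4⟩ := scan_spec hEρ (by rw [ha 4 (by decide)]; exact hxτ) h1
    refine ⟨h3.setReg (by decide) _, ?_⟩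
    rcases h4 with ⟨h4, h5⟩ | ⟨h4, h5⟩
    · rcases h2 with h2 | h2
      · left
        simp
        omega
      · exact absurd h2 h4
    · right
      intro b l
      have := h5 b l
      rw [Visited, ← h4.1] at this
      exact this
  refine ⟨key.1, key.2.resolve_left ?_⟩
  have := key.1.le_card
  omega

/-- Discovery numbers strictly decrease along the path. Hence the bakers recorded at locations
numbered no higher than the current one are still where they were in `x`, and the walk arrives at
`c` within `nl` rounds. -/
theorem follow_spec (hE : Env G σ) (hx : ∀ b : Fin nb, σ.arr 4 b = x b) (hf : G.Feasible x)
    (hT : Tree G x c σ) {a : Fin nl} (ha : σ.reg 35 = a) (ha0 : σ.arr 11 a ≠ 0) :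
    ∃ x', (∀ b : Fin nb, (follow.sem σ).arr 4 b = x' b) ∧ G.Feasible x' ∧ Shift x x' a c := by
  have key : ∃ (x' : Fin nb → Fin nl) (k : Fin nl), (follow.sem σ).reg 37 = k ∧
      (∀ b : Fin nb, (follow.sem σ).arr 4 b = x' b) ∧ G.Feasible x' ∧ Shift x x' a k ∧
      σ.arr 11 k ≠ 0 ∧ (k = c ∨ σ.arr 11 k + nl ≤ σ.arr 11 a) ∧
      ∀ l ≠ c, σ.arr 11 l ≠ 0 → σ.arr 11 l ≤ σ.arr 11 k → ∀ b : Fin nb, σ.arr 12 l = b →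
        x' b = l := by
    refine Code.sem_count (fun i τ => ∃ (x' : Fin nb → Fin nl) (k : Fin nl), τ.reg 37 = k ∧
      (∀ b : Fin nb, τ.arr 4 b = x' b) ∧ G.Feasible x' ∧ Shift x x' a k ∧
      σ.arr 11 k ≠ 0 ∧ (k = c ∨ σ.arr 11 k + i ≤ σ.arr 11 a) ∧
      ∀ l ≠ c, σ.arr 11 l ≠ 0 → σ.arr 11 l ≤ σ.arr 11 k → ∀ b : Fin nb, σ.arr 12 l = b →
        x' b = l) (by simpa [Code.sem] using hE.reg2)
      ⟨x, a, by simp [Code.sem, Expr.val, ha], by simpa [Code.sem] using hx, hf, Shift.refl x a, ha0,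
        Or.inr le_rfl, fun l hlc hl0 _ b hb => ?_⟩ ?_
    · obtain ⟨-, b', -, hb', -, hx', -⟩ := hT.next l hlc hl0
      obtain rfl : b = b' := Fin.ext (hb.symm.trans hb')
      exact hx'
    rintro i τ hi hτi hr ha' ⟨x', k, h37, h4, hf', hs, hk0, hk, hx'⟩
    have h11 : τ.arr 11 = σ.arr 11 := ha' 11 (by decide)
    have h12 : τ.arr 12 = σ.arr 12 := ha' 12 (by decide)
    have h13 : τ.arr 13 = σ.arr 13 := ha' 13 (by decide)
    by_cases hkc : k = c
    · refine ⟨x', k, ?_⟩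
      have : σ.arr 11 k = 1 := hkc ▸ hT.root
      rw [Code.sem, if_neg (by simp [Expr.val, h37, h11, this]), Code.sem]
      exact ⟨h37, h4, hf', hs, hk0, Or.inl hkc, hx'⟩
    obtain ⟨h1, b, l, hb, hl, -, hlf, hl0, hlt⟩ := hT.next k hkc hk0
    have hxb : x' b = k := hx' k hkc hk0 le_rfl b hb
    have hb' : τ.arr 12 k = b := by rw [h12, hb]
    have hl' : τ.arr 13 k = l := by rw [h13, hl]
    have hmove : (Expr.sub (.get 11 (.reg 37)) (.const 1)).val τ ≠ 0 := by
      simp only [Expr.val, h37, h11]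
      omega
    refine ⟨Function.update x' b l, l, ?_, fun b' => ?_, fun b' => ?_, ?_, hl0, Or.inr ?_,
      fun l' hlc hl0' hle b' hb' => ?_⟩
    · rw [Code.sem, if_pos hmove]
      simp [Code.sem, Expr.val, h37, hl']
    · rw [Code.sem, if_pos hmove]
      by_cases h : b' = b
      · simp [Code.sem, Expr.val, h, h37, hl', hb']
      · simp [Code.sem, Expr.val, h, h37, hb', h4, Fin.val_inj]
    · by_cases h : b' = b
      · subst h; simpa using hlf
      · simpa [h] using hf' b'
    · refine hs.trans ?_
      rw [← hxb]
      exact shift_update x' b l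
    · rcases hk with hk | hk
      · exact absurd hk hkc
      · omega
    · have h2 := hx' l' hlc hl0' (by omega) b' hb'
      -- The baker just moved stood at `k`, whose number exceeds that of the new position `l`; so
      -- she is not recorded at any location still ahead.
      have hne : b' ≠ b := by
        rintro rfl
        rw [hxb] at h2
        rw [h2] at hlt
        omega
      rw [Function.update_of_ne hne, h2]
  obtain ⟨x', k, -, h4, hf', hs, hk0, hk, -⟩ := key
  -- Otherwise the number has dropped by `nl` from a value at most `nl`, leaving 0 at a reached
  -- location.
  rcases hk with rfl | hk
  · exact ⟨x', h4, hf', hs⟩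
  · have := hT.le a
    have := hT.le_card
    omega

/-- Array 4 holds the feasible baker profile `x`, and arrays 10 and 9 hold the counts of `x` and of
the miller profile `t`. -/
structure State (G : Game (Fin nb) (Fin nm) (Fin nl)) (t : Fin nm → Fin nl) (x : Fin nb → Fin nl)
    (σ : Memory) : Prop where
  env : Env G σ
  prof : ∀ b : Fin nb, σ.arr 4 b = x b
  feasible : G.Feasible x
  bakers : ∀ l : Fin nl, σ.arr 10 l = count x l
  millers : ∀ l : Fin nl, σ.arr 9 l = count t l

variable {t : Fin nm → Fin nl}

theorem State.setReg (h : State G t x σ) {r : ℕ} (hr : 3 ≤ r) (v : ℕ) :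
    State G t x (σ.setReg r v) :=
  ⟨h.env.congr (fun q hq => by rw [Memory.setReg_reg, if_neg (by omega)]) rfl rfl, h.prof,
    h.feasible, h.bakers, h.millers⟩

theorem State.sem (h : State G t x σ) {P : Code} (hP : P.wf = true) (h0 : 0 ∉ P.arrs)
    (h5 : 5 ∉ P.arrs) (h4 : 4 ∉ P.arrs) (h10 : 10 ∉ P.arrs) (h9 : 9 ∉ P.arrs) :
    State G t x (P.sem σ) :=
  ⟨h.env.sem hP h0 h5, by rw [Code.sem_arr _ h4]; exact h.prof, h.feasible,
    by rw [Code.sem_arr _ h10]; exact h.bakers, by rw [Code.sem_arr _ h9]; exact h.millers⟩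

theorem State.augment (h : State G t x σ) (hT : Tree G x c σ) {a : Fin nl} (hac : a ≠ c)
    (ha : σ.reg 35 = a) (hc : σ.reg 30 = c) (ha0 : σ.arr 11 a ≠ 0) :
    ∃ x', State G t x' (augment.sem σ) ∧ Shift x x' a c := by
  obtain ⟨x', h4, hf, hs⟩ := follow_spec h.env h.prof h.feasible hT ha ha0
  refine ⟨x', ⟨h.env.sem rfl (by decide) (by decide), h4, hf, fun l => ?_, ?_⟩, hs⟩
  · have h35 : (follow.sem σ).reg 35 = a := by rw [Code.sem_reg _ (by decide), ha]
    have h30 : (follow.sem σ).reg 30 = c := by rw [Code.sem_reg _ (by decide), hc]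
    have h10 : ∀ l : Fin nl, (follow.sem σ).arr 10 l = count x l := by
      rw [Code.sem_arr _ (by decide)]; exact h.bakers
    have := hs l
    simp only [BakersMillers.augment, Code.sem, Expr.val, h35, h30, Memory.setArr_arr,
      Memory.setArr_reg, h10,
      true_and, Fin.val_inj]
    by_cases hla : l = a
    · subst hla
      simp only [hac, if_true, if_false] at this ⊢
      omega
    · by_cases hlc : l = c
      · subst hlc
        simp only [hla, if_true, if_false] at this ⊢
        omega
      · simp only [hla, hlc, if_false] at this ⊢
        omega
  · rw [Code.sem_arr _ (by decide)]
    exact h.millers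

/-- The state has developed from one with profile `x`: either the potential has increased, or the
profile is still `x` and `Q` holds. -/
def Improved (G : Game (Fin nb) (Fin nm) (Fin nl)) (t : Fin nm → Fin nl) (x : Fin nb → Fin nl)
    (σ : Memory) (Q : Prop) : Prop :=
  (∃ x', State G t x' σ ∧ ¬ G.Stable t x ∧ potential t x + 1 / (nb : ℚ) ^ 2 ≤ potential t x') ∨
    State G t x σ ∧ Q

theorem Improved.mono {Q R : Prop} (h : Improved G t x σ Q) (hQR : Q → R) : Improved G t x σ R :=
  h.imp_right fun h => ⟨h.1, hQR h.2⟩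

theorem Improved.setReg {Q : Prop} (h : Improved G t x σ Q) {r : ℕ} (hr : 3 ≤ r) (v : ℕ) :
    Improved G t x (σ.setReg r v) Q := by
  rcases h with ⟨x', h1, h2⟩ | ⟨h1, h2⟩
  · exact Or.inl ⟨x', h1.setReg hr v, h2⟩
  · exact Or.inr ⟨h1.setReg hr v, h2⟩

/-- Shifting a baker from `a` to `c` does not improve the potential. -/
def Blocked (G : Game (Fin nb) (Fin nm) (Fin nl)) (t : Fin nm → Fin nl) (x : Fin nb → Fin nl)
    (a c : Fin nl) : Prop :=
  Relation.ReflTransGen (G.Edge x) a c → count t c * count x a ≤ count t a * (count x c + 1)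

/-- The search decides reachability of `c` from `a`, and the test compares the marginal values of
the shift by cross-multiplication. A failed attempt therefore certifies `Blocked`. -/
theorem State.attempt (h : State G t x σ) {a : Fin nl} (ha : σ.reg 35 = a) (hc : σ.reg 30 = c) :
    Improved G t x (attempt.sem σ) (Blocked G t x a c) := by
  obtain ⟨hT, hV⟩ := search_spec h.env h.prof hc
  have hS₀ : State G t x (search.sem σ) :=
    h.sem rfl (by decide) (by decide) (by decide) (by decide) (by decide)
  have h35 : (search.sem σ).reg 35 = a := by rw [Code.sem_reg _ (by decide), ha]
  have h30 : (search.sem σ).reg 30 = c := by rw [Code.sem_reg _ (by decide), hc]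
  set P₁ : Code := .set 21 (.get 10 (.reg 35)) ;; .set 22 (.get 9 (.reg 30)) with hP₁
  set P₂ : Code := mul ;; .set 36 (.reg 23) ;; .set 21 (.get 10 (.reg 30)) ;;
    .set 22 (.get 9 (.reg 35)) with hP₂
  set σ₁ := P₁.sem (search.sem σ) with hσ₁
  set σ₂ := P₂.sem σ₁ with hσ₂
  have hS₁ : State G t x σ₁ :=
    hS₀.sem rfl (by decide) (by decide) (by decide) (by decide) (by decide)
  have hS₂ : State G t x σ₂ :=
    hS₁.sem rfl (by decide) (by decide) (by decide) (by decide) (by decide)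
  have hS₃ : State G t x (mul.sem σ₂) :=
    hS₂.sem rfl (by decide) (by decide) (by decide) (by decide) (by decide)
  have hm₁ := mul_spec hS₁.env (x := count x a) (y := count t c)
    (by simp [hσ₁, hP₁, Code.sem, Expr.val, h35, hS₀.bakers])
    ((count_le_card _ _).trans (by simp))
    (by simp [hσ₁, hP₁, Code.sem, Expr.val, h30, hS₀.millers])
  have h35' : (mul.sem σ₁).reg 35 = a := by
    rw [Code.sem_reg _ (by decide), hσ₁, Code.sem_reg _ (by decide), h35]
  have h30' : (mul.sem σ₁).reg 30 = c := by
    rw [Code.sem_reg _ (by decide), hσ₁, Code.sem_reg _ (by decide), h30]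
  have hS₁' : State G t x (mul.sem σ₁) :=
    hS₁.sem rfl (by decide) (by decide) (by decide) (by decide) (by decide)
  have hm₂ := mul_spec hS₂.env (x := count x c) (y := count t a)
    (by simp [hσ₂, hP₂, Code.sem, Expr.val, h30', hS₁'.bakers])
    ((count_le_card _ _).trans (by simp))
    (by simp [hσ₂, hP₂, Code.sem, Expr.val, h35', hS₁'.millers])
  set σ₃ := mul.sem σ₂ with hσ₃
  have h36 : σ₃.reg 36 = count x a * count t c := by
    rw [hσ₃, Code.sem_reg _ (by decide), ← hm₁]
    simp [hσ₂, hP₂, Code.sem, Expr.val]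
  have h35₃ : σ₃.reg 35 = a := by
    rw [hσ₃, Code.sem_reg _ (by decide), hσ₂, Code.sem_reg _ (by decide), hσ₁,
      Code.sem_reg _ (by decide), h35]
  have h30₃ : σ₃.reg 30 = c := by
    rw [hσ₃, Code.sem_reg _ (by decide), hσ₂, Code.sem_reg _ (by decide), hσ₁,
      Code.sem_reg _ (by decide), h30]
  have harr : σ₃.arr = (search.sem σ).arr := by
    funext k
    rw [hσ₃, Code.sem_arr _ (by simp [mul, Code.arrs]), hσ₂,
      Code.sem_arr _ (by simp [hP₂, mul, Code.arrs]), hσ₁, Code.sem_arr _ (by simp [hP₁, Code.arrs])]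
  have hT₃ : Tree G x c σ₃ := by
    have h31 : σ₃.reg 31 = (search.sem σ).reg 31 := by
      rw [hσ₃, Code.sem_reg _ (by decide), hσ₂, Code.sem_reg _ (by decide), hσ₁,
        Code.sem_reg _ (by decide)]
    exact ⟨by rw [harr]; exact hT.root, by rw [harr, h31]; exact hT.le,
      by rw [h31, hT.card, harr], by rw [harr]; exact hT.next⟩
  change Improved G t x ((Code.ite (.get 11 (.reg 35))
    (.ite (.sub (.reg 36) (.add (.reg 23) (.get 9 (.reg 35)))) BakersMillers.augment .skip)
    .skip).sem σ₃) _
  simp only [Code.sem, Expr.val, h35₃, h36, hm₂, hS₃.millers]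
  by_cases ha0 : σ₃.arr 11 a = 0
  · rw [if_neg (by simpa using ha0)]
    refine Or.inr ⟨hS₃, fun hr => absurd ha0 ?_⟩
    rw [harr]
    exact hT.of_reach hV hr
  rw [if_pos ha0]
  by_cases hlt : count t a * (count x c + 1) < count t c * count x a
  · rw [if_pos (by rw [Nat.sub_ne_zero_iff_lt]; linarith)]
    have hac : a ≠ c := by
      rintro rfl
      exact absurd hlt (not_lt.2 (Nat.mul_le_mul_left _ (Nat.le_succ _)))
    obtain ⟨x', h1, h2⟩ := hS₃.augment hT₃ hac h35₃ h30₃ ha0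
    refine Or.inl ⟨x', h1, fun hst => absurd hlt (not_lt.2 (hst a c (hT₃.reach ha0))), ?_⟩
    simpa using potential_add_le t h2 hlt
  · rw [if_neg (by rw [Nat.sub_ne_zero_iff_lt]; intro; apply hlt; linarith)]
    exact Or.inr ⟨hS₃, fun _ => not_lt.1 hlt⟩

/-- A gain already made persists, since an attempt never lowers the potential. Without a gain the
profile is unchanged, so certificates about `x` accumulate. -/
theorem Improved.attempt {Q : Prop} (h : Improved G t x σ Q) {a : Fin nl} (ha : σ.reg 35 = a)
    (hc : σ.reg 30 = c) : Improved G t x (attempt.sem σ) (Q ∧ Blocked G t x a c) := by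
  rcases h with ⟨x', h1, h2, h3⟩ | ⟨h1, h2⟩
  · rcases h1.attempt ha hc with ⟨x'', h4, -, h5⟩ | ⟨h4, -⟩
    · refine Or.inl ⟨x'', h4, h2, h3.trans (le_trans ?_ h5)⟩
      have : 0 ≤ 1 / (nb : ℚ) ^ 2 := by positivity
      linarith
    · exact Or.inl ⟨x', h4, h2, h3⟩
  · exact (h1.attempt ha hc).mono fun h => ⟨h2, h⟩

theorem Improved.env {Q : Prop} (h : Improved G t x σ Q) : Env G σ := by
  rcases h with ⟨x', h1, -⟩ | ⟨h1, -⟩ <;> exact h1.env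

theorem State.sweep (h : State G t x σ) : Improved G t x (sweep.sem σ) (G.Stable t x) := by
  suffices key : Improved G t x (BakersMillers.sweep.sem σ)
      (∀ c : Fin nl, (c : ℕ) < nl → ∀ a, Blocked G t x a c) from
    key.mono fun h a c => h c c.2 a
  refine Code.sem_count (fun i τ => Improved G t x τ
    (∀ c : Fin nl, (c : ℕ) < i → ∀ a, Blocked G t x a c)) (by simpa using h.env.reg2)
    (Or.inr ⟨h.setReg (by decide) 0, by simp⟩) ?_
  intro i τ hi hτi _ _ h1
  have h2 : Improved G t x ((Code.count 35 2 0 BakersMillers.attempt).sem τ)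
      ((∀ c : Fin nl, (c : ℕ) < i → ∀ a, Blocked G t x a c) ∧
        ∀ a : Fin nl, (a : ℕ) < nl → Blocked G t x a ⟨i, hi⟩) := by
    refine Code.sem_count (fun j ρ => Improved G t x ρ
      ((∀ c : Fin nl, (c : ℕ) < i → ∀ a, Blocked G t x a c) ∧
        ∀ a : Fin nl, (a : ℕ) < j → Blocked G t x a ⟨i, hi⟩)) (by simpa using h1.env.reg2)
      ((h1.mono fun h => ⟨h, by simp⟩).setReg (by decide) 0) ?_
    intro j ρ hj hρj hr' _ h3
    have h4 := h3.attempt (a := ⟨j, hj⟩) (c := ⟨i, hi⟩) hρj (by rw [hr' 30 (by decide), hτi])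
    refine (h4.mono fun h => ⟨h.1.1, fun a ha => ?_⟩).setReg (by decide) _
    rcases Nat.lt_succ_iff_lt_or_eq.1 ha with ha | ha
    · exact h.1.2 a ha
    · obtain rfl : a = ⟨j, hj⟩ := Fin.ext ha
      exact h.2
  refine (h2.mono fun h c hc a => ?_).setReg (by decide) _
  rcases Nat.lt_succ_iff_lt_or_eq.1 hc with hc | hc
  · exact h.1 c hc a
  · obtain rfl : c = ⟨i, hi⟩ := Fin.ext hc
    exact h.2 a a.2

/-- The state after `n` sweeps. -/
def Swept (G : Game (Fin nb) (Fin nm) (Fin nl)) (t : Fin nm → Fin nl) (n : ℕ) (σ : Memory) : Prop :=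
  ∃ x, State G t x σ ∧ (G.Stable t x ∨ n * (1 / (nb : ℚ) ^ 2) ≤ potential t x)

/-- A sweep that changes the profile shows that it was not stable, so the lower bound on the
potential was in force and grows by one more gain. -/
theorem Swept.sweep {n : ℕ} (h : Swept G t n σ) : Swept G t (n + 1) (sweep.sem σ) := by
  obtain ⟨x, h1, h2⟩ := h
  rcases h1.sweep with ⟨x', h3, h4, h5⟩ | ⟨h3, h4⟩
  · refine ⟨x', h3, Or.inr (le_trans ?_ h5)⟩
    have := h2.resolve_left h4
    push_cast
    linarith
  · exact ⟨x, h3, Or.inl h4⟩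

theorem Swept.count {P : Code} {d : ℕ}
    (hP : ∀ n τ, Swept G t n τ → Swept G t (n + d) (P.sem τ)) {r k c : ℕ} (hr : 3 ≤ r) {m : ℕ}
    (hm : ∀ τ, Env G τ → τ.reg k + c = m) (n : ℕ) (σ : Memory) (h : Swept G t n σ) :
    Swept G t (n + m * d) ((Code.count r k c P).sem σ) := by
  have hset : ∀ n τ v, Swept G t n τ → Swept G t n (τ.setReg r v) := fun n τ v ⟨x, h1, h2⟩ =>
    ⟨x, h1.setReg hr v, h2⟩
  refine Code.sem_count (fun i τ => Swept G t (n + i * d) τ)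
    (hm σ (by obtain ⟨x, h1, -⟩ := h; exact h1.env)) (hset _ _ _ (by simpa using h)) ?_
  intro i τ _ _ _ _ h1
  refine hset _ _ _ ?_
  rw [Nat.succ_mul, ← Nat.add_assoc]
  exact hP _ _ h1

theorem State.improve (h : State G t x σ) :
    ∃ x', State G t x' (improve.sem σ) ∧ G.Stable t x' := by
  have h0 : Swept G t 0 σ := ⟨x, h, Or.inr (by simpa using potential_nonneg t x)⟩
  have hb : ∀ τ, Env G τ → τ.reg 0 + 0 = nb := fun τ hτ => hτ.reg0
  have hmil : ∀ τ, Env G τ → τ.reg 1 + 1 = nm + 1 := fun τ hτ => by rw [hτ.reg1]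
  obtain ⟨x', h1, h2⟩ := Swept.count (Swept.count (Swept.count (Swept.count
    (P := BakersMillers.sweep) (d := 1) (fun n τ h => h.sweep) (r := 43) (by decide) hb)
    (r := 42) (by decide) hb) (r := 41) (by decide) hb) (r := 40) (by decide) hmil 0 σ h0
  refine ⟨x', h1, ?_⟩
  rcases h2 with h2 | h2
  · exact h2
  have hle := h2.trans (potential_le t x')
  -- Without bakers there are no sweeps, but stability is trivial. Otherwise (nm+1)·nb³ gains of
  -- 1/nb² add up to (nm+1)·nb, above the maximum nm·nb.
  rcases Nat.eq_zero_or_pos nb with rfl | hpos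
  · intro a c _
    have : count x' a = 0 := Nat.le_zero.1 ((count_le_card x' a).trans (by simp))
    rw [this]
    exact Nat.zero_le _
  · exfalso
    have hnb : (0 : ℚ) < nb := by exact_mod_cast hpos
    have : ((0 + (nm + 1) * (nb * (nb * (nb * 1))) : ℕ) : ℚ) * (1 / (nb : ℚ) ^ 2) =
        (nm + 1) * nb := by
      push_cast
      field_simp
      ring
    rw [this, Fintype.card_fin, Fintype.card_fin] at hle
    linarith

end Spec

/-! ### The complete program -/

/-- Array 4 gets the profile in array 2. -/
def copyProfile : Code := .count 25 0 0 (.store 4 (.reg 25) (.get 2 (.reg 25)))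

/-- The whole algorithm. -/
def nashCode : Code :=
  rowStarts ;; greedy ;; addCounts 2 8 ;; insertion ;; copyProfile ;; addCounts 4 10 ;; improve

section Spec

variable {nb nm nl : ℕ} {σ : Memory}

theorem copyProfile_spec (hb : σ.reg 0 = nb) : ∀ j < nb, (copyProfile.sem σ).arr 4 j = σ.arr 2 j := by
  refine Code.sem_count (fun i τ => ∀ j < i, τ.arr 4 j = σ.arr 2 j) (by simpa using hb) (by simp) ?_
  intro i τ _ hτi _ ha h j hj
  by_cases hji : j = i
  · simp [Code.sem, Expr.val, hτi, hji, ha 2 (by decide)]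
  · simp [Code.sem, Expr.val, hτi, hji, h j (by omega)]

/-- The greedy profile starts the improvement phase. It is copied to array 4 first, so that array 2
still holds it as output. -/
theorem nashCode_spec (G : Game (Fin nb) (Fin nm) (Fin nl)) (hnl : 0 < nl) :
    ∃ (ord : Fin nl ≃ Fin nl) (s : Fin nb → Fin nl) (t : Fin nm → Fin nl) (s' : Fin nb → Fin nl),
      (nashCode.sem G.encode).Holds 1 ord ∧ (nashCode.sem G.encode).Holds 2 s ∧
      (nashCode.sem G.encode).Holds 3 t ∧ (nashCode.sem G.encode).Holds 4 s' ∧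
      G.IsRun ord s (Equiv.refl (Fin nm)) t s' := by
  have hzero : ∀ a k, a ≠ 0 → G.encode.arr a k = 0 := fun a k ha => by simp [Game.encode, ha]
  set σ₁ := rowStarts.sem G.encode with hσ₁
  have hE₁ : Env G σ₁ := env_rowStarts G
  have hz₁ : ∀ a, a ≠ 0 → a ≠ 5 → ∀ k, σ₁.arr a k = 0 := fun a h0 h5 k => by
    rw [hσ₁, Code.sem_arr _ (by simpa [rowStarts, Code.arrs] using h5), hzero a k h0]
  obtain ⟨ord, s, ho, hs, hgo, hga⟩ := greedy_spec hE₁ hnl (hz₁ 2 (by decide) (by decide))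
    (hz₁ 6 (by decide) (by decide)) (hz₁ 7 (by decide) (by decide))
  set σ₂ := greedy.sem σ₁ with hσ₂
  have hE₂ : Env G σ₂ := hE₁.sem rfl (by decide) (by decide)
  have h8 := addCounts_spec hE₂ (a := 2) (c := 8) (by decide) hs
    (by rw [hσ₂, Code.sem_arr _ (by decide)]; exact hz₁ 8 (by decide) (by decide))
  set σ₃ := (addCounts 2 8).sem σ₂ with hσ₃
  have hE₃ : Env G σ₃ := hE₂.sem rfl (by decide) (by decide)
  have ho₃ : σ₃.Holds 1 ord := by
    rw [Memory.Holds, hσ₃, Code.sem_arr _ (by decide)]; exact ho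
  obtain ⟨t, ht, h9, hins⟩ := insertion_spec hE₃ hnl ho₃ h8 (by
    rw [hσ₃, Code.sem_arr _ (by decide), hσ₂, Code.sem_arr _ (by decide)]
    exact hz₁ 9 (by decide) (by decide))
  set σ₄ := insertion.sem σ₃ with hσ₄
  have hE₄ : Env G σ₄ := hE₃.sem rfl (by decide) (by decide)
  have hs₄ : ∀ b : Fin nb, σ₄.arr 2 b = s b := by
    rw [hσ₄, Code.sem_arr _ (by decide), hσ₃, Code.sem_arr _ (by decide)]; exact hs
  have h4 := copyProfile_spec hE₄.reg0
  set σ₅ := copyProfile.sem σ₄ with hσ₅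
  have hE₅ : Env G σ₅ := hE₄.sem rfl (by decide) (by decide)
  have hs₅ : ∀ b : Fin nb, σ₅.arr 4 b = s b := fun b => by rw [h4 b b.2, hs₄]
  have h10 := addCounts_spec hE₅ (a := 4) (c := 10) (by decide) hs₅ (by
    rw [hσ₅, Code.sem_arr _ (by decide), hσ₄, Code.sem_arr _ (by decide), hσ₃,
      Code.sem_arr _ (by decide), hσ₂, Code.sem_arr _ (by decide)]
    exact hz₁ 10 (by decide) (by decide))
  set σ₆ := (addCounts 4 10).sem σ₅ with hσ₆
  have hS : State G t s σ₆ :=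
    ⟨hE₅.sem rfl (by decide) (by decide),
      by rw [hσ₆, Code.sem_arr _ (by decide)]; exact hs₅, fun b => (hga.spec b).1, h10,
      by rw [hσ₆, Code.sem_arr _ (by decide), hσ₅, Code.sem_arr _ (by decide)]; exact h9⟩
  obtain ⟨s', hS', hst⟩ := hS.improve
  have hfin : nashCode.sem G.encode = improve.sem σ₆ := rfl
  rw [hfin]
  refine ⟨ord, s, t, s', ?_, ?_, ?_, hS'.prof, ⟨hgo, hga, hins, hst.isPotentialMaximizer hS'.feasible⟩⟩
  · rw [Memory.Holds, Code.sem_arr _ (by decide), hσ₆, Code.sem_arr _ (by decide), hσ₅,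
      Code.sem_arr _ (by decide), hσ₄, Code.sem_arr _ (by decide)]
    exact ho₃
  · rw [Memory.Holds, Code.sem_arr _ (by decide), hσ₆, Code.sem_arr _ (by decide), hσ₅,
      Code.sem_arr _ (by decide)]
    exact hs₄
  · rw [Memory.Holds, Code.sem_arr _ (by decide), hσ₆, Code.sem_arr _ (by decide), hσ₅,
      Code.sem_arr _ (by decide)]
    exact ht

end Spec

/-! ### Transport along bijections -/

theorem update_transport {A A' L L' : Type*} [DecidableEq A] [DecidableEq A'] (eA : A ≃ A') (eL : L ≃ L')
    (x : A' → L') (a : A) (l : L) : Function.update (fun a => eL.symm (x (eA a))) a l =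
      fun a' => eL.symm (Function.update x (eA a) (eL l) (eA a')) := by
  funext a'
  by_cases h : a' = a
  · subst h; simp
  · simp [h]

section Transport

variable {A A' L L' : Type*} [Fintype A] [Fintype A'] [DecidableEq L] [DecidableEq L']

theorem count_transport (eA : A ≃ A') (eL : L ≃ L') (x : A' → L') (l : L) :
    count (fun a => eL.symm (x (eA a))) l = count x (eL l) := by
  refine Finset.card_equiv eA fun a => ?_
  simp [Equiv.symm_apply_eq]

theorem Game.IsPureNash.transport {B M B' M' : Type*} [Fintype B] [Fintype M] [Fintype B']
    [Fintype M'] [DecidableEq B] [DecidableEq M] [DecidableEq B'] [DecidableEq M']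
    {G : Game B M L} {G' : Game B' M' L'} (eB : B ≃ B') (eM : M ≃ M') (eL : L ≃ L')
    (hG : ∀ b l, eL l ∈ G'.feas (eB b) ↔ l ∈ G.feas b) {s : B' → L'} {t : M' → L'}
    (h : G'.IsPureNash s t) :
    G.IsPureNash (fun b => eL.symm (s (eB b))) (fun m => eL.symm (t (eM m))) := by
  obtain ⟨h1, h2, h3⟩ := h
  refine ⟨fun b => ?_, fun b l hl => ?_, fun m l => ?_⟩
  · rw [← hG]
    simpa using h1 (eB b)
  · have := h2 (eB b) (eL l) ((hG b l).2 hl)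
    rw [update_transport]
    simpa only [bakerUtility, count_transport, Equiv.apply_symm_apply] using this
  · have := h3 (eM m) (eL l)
    rw [update_transport]
    simpa only [millerUtility, count_transport, Equiv.apply_symm_apply] using this

/-- Existence is read off from the output of the program on a relabelled copy of the game. -/
theorem Game.exists_isPureNash {B M : Type*} [Fintype B] [Fintype M] [Fintype L] [DecidableEq B]
    [DecidableEq M] [Nonempty L] (G : Game B M L) :
    ∃ (s : B → L) (t : M → L), G.IsPureNash s t := by
  let eB := Fintype.equivFin B
  let eL := Fintype.equivFin L
  let G' : Game (Fin (Fintype.card B)) (Fin (Fintype.card M)) (Fin (Fintype.card L)) :=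
    ⟨fun b => (G.feas (eB.symm b)).map eL.toEmbedding, fun b => (G.feas_nonempty _).map⟩
  obtain ⟨ord, s, t, s', -, -, -, -, h⟩ := nashCode_spec G' Fintype.card_pos
  exact ⟨_, _, h.isPureNash.transport eB (Fintype.equivFin M) eL fun b l => by simp [G']⟩

end Transport

end BakersMillers
theorem mainTheorem1 :
    -- every run of the algorithm, however ties are broken, returns a pure Nash equilibrium
    (∀ {B M L : Type*} [Fintype B] [Fintype M] [Fintype L]
        [DecidableEq B] [DecidableEq M] [DecidableEq L] (G : Game B M L)
        {p q : ℕ} (ord : Fin p ≃ L) (s : B → L) (e : Fin q ≃ M) (t : M → L) (s' : B → L),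
        G.IsRun ord s e t s' → G.IsPureNash s' t) ∧
    -- the algorithm can be carried out by a program in polynomial time
    (∃ (P : Prog) (f : Polynomial ℕ),
      ∀ (nb nm nl : ℕ) (G : Game (Fin nb) (Fin nm) (Fin nl)), 0 < nl →
        ∃ (n : ℕ) (τ : Memory), Exec P G.encode n τ ∧ n ≤ f.eval (nb + nm + nl) ∧
          ∃ (ord : Fin nl ≃ Fin nl) (s : Fin nb → Fin nl) (t : Fin nm → Fin nl)
            (s' : Fin nb → Fin nl),
            τ.Holds 1 ord ∧ τ.Holds 2 s ∧ τ.Holds 3 t ∧ τ.Holds 4 s' ∧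
            G.IsRun ord s (Equiv.refl (Fin nm)) t s' ∧ G.IsPureNash s' t) ∧
    -- a pure Nash equilibrium always exists
    (∀ {B M L : Type*} [Fintype B] [Fintype M] [Fintype L]
        [DecidableEq B] [DecidableEq M] [DecidableEq L] [Nonempty L] (G : Game B M L),
        ∃ (s : B → L) (t : M → L), G.IsPureNash s t) := by
  refine ⟨fun G _ _ ord s e t s' h => h.isPureNash, ?_, fun G => G.exists_isPureNash⟩
  obtain ⟨f, hf⟩ := Code.exists_exec (P := nashCode) rfl
  refine ⟨nashCode.toProg, f, fun nb nm nl G hnl => ?_⟩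
  obtain ⟨n, hn, hnf⟩ := hf G.encode
  obtain ⟨ord, s, t, s', h1, h2, h3, h4, hrun⟩ := nashCode_spec G hnl
  exact ⟨n, _, hn, hnf, ord, s, t, s', h1, h2, h3, h4, hrun, hrun.isPureNash⟩
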